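/- Let the scalar field be $\mathbb{K}=\mathbb{R}$ or $\mathbb{C}$, let $n\in\mathbb{N}$, and let $K_1,\dots,K_n$ be infinite, scattered (every non-empty subset has an isolated point), compact Hausdorff spaces. For a scattered compact Hausdorff space $K$, let $K^0=K$, let $K^{\xi+1}$ be the set of non-isolated points of $K^\xi$, let $K^\xi=\bigcap_{\zeta<\xi}K^\zeta$ for limit $\xi$, and let $CB(K)$ be the least ordinal $\xi$ with $K^\xi=\varnothing$. Let $\gamma(K)=0$ if $K$ is finite, and otherwise $\gamma(K)=\omega^{\gamma}$, where $\gamma$ is the unique ordinal with $\omega^{\gamma}<CB(K)<\omega^{\gamma+1}$. Closed subsets of $K$ carry the subspace topology. For $1\le m\le n$ and a closed set $S\subset K_m$, let $$Q^m_S:\ \widehat{\otimes}_{\pi,i=1}^n C(K_i)\to \widehat{\otimes}_{\pi,i=1}^n C(L_i),\qquad L_m=S,\quad L_i=K_i\ (i\ne m),$$ be the continuous linear extension of $\otimes_{i=1}^n f_i\mapsto\otimes_{i=1}^n g_i$, where $g_m=f_m|_S$ and $g_i=f_i$ for $i\neq m$ (if $S=\varnothing$, this is the zero operator into the zero space). Here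 $\widehat{\otimes}_{\pi}$ is the completed projective tensor product and $C(\cdot)$ denotes the $\mathbb{K}$-valued continuous functions with the supremum norm. Let $Z$ be an infinite-dimensional closed linear subspace of $\widehat{\otimes}_{\pi,i=1}^n C(K_i)$ such that $Q^m_S|_Z$ is strictly singular (not bounded below on any infinite-dimensional subspace of $Z$) for every $1\le m\le n$ and every closed $S\subset K_m$ with $\gamma(S)<\gamma(K_m)$. Then $Z$ contains an isomorph of $c_0$, that is, a linear subspace linearly homeomorphic to $c_0$. -/

import Mathlib

universe u v

noncomputable section

open TopologicalSpace UniformSpace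
open scoped TensorProduct ZeroAtInfty

namespace ProjTensorCK

section CantorBendixsonIndex

/-- A topological space is scattered if every non-empty subset `A` has an isolated point,
that is, a point `x ∈ A` such that `{x}` is relatively open in `A`. -/
def IsScattered (X : Type u) [TopologicalSpace X] : Prop :=
  ∀ A : Set X, A.Nonempty → ∃ x ∈ A, ∃ U : Set X, IsOpen U ∧ U ∩ A = {x}

/-- The Cantor-Bendixson index `CB(X)`: the least ordinal `ξ` with `X^ξ = ∅`, where
`X^0 = X`, `X^{ξ+1}` is the set of points of `X^ξ` that are not isolated in `X^ξ`, and
intersections are taken at limit ordinals. (Used only for scattered spaces, where such an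
ordinal exists.) -/
def cbIndex (X : Type u) [TopologicalSpace X] : Ordinal.{u} :=
  sInf {ξ : Ordinal.{u} | CantorBendixson.iteratedDerivedSet (Set.univ : Set X) ξ = ∅}

open Classical in
/-- `γ(X) = 0` if `X` is finite; otherwise `γ(X) = ω ^ γ`, where `γ` is the largest ordinal with
`ω ^ γ ≤ CB(X)`. For infinite scattered compact Hausdorff `X` this is the unique ordinal `γ` with
`ω ^ γ < CB(X) < ω ^ (γ + 1)`, see `gammaIndex_spec` and `gammaIndex_unique`. -/
def gammaIndex (X : Type u) [TopologicalSpace X] : Ordinal.{u} :=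
  if Finite X then 0 else Ordinal.omega0 ^ Ordinal.log Ordinal.omega0 (cbIndex X)

theorem iteratedDerivedSet_cbIndex {X : Type u} [TopologicalSpace X] (hX : IsScattered X) :
    CantorBendixson.iteratedDerivedSet (Set.univ : Set X) (cbIndex X) = ∅ := by
  have hne : {ξ : Ordinal.{u} |
      CantorBendixson.iteratedDerivedSet (Set.univ : Set X) ξ = ∅}.Nonempty := by
    obtain ⟨a, ha⟩ := CantorBendixson.iteratedDerivedSet_mem_fixedPoints (Set.univ : Set X)
    refine ⟨a, ?_⟩
    by_contra hA
    obtain ⟨x, hx, U, hU, hUA⟩ := hX _ (Set.nonempty_iff_ne_empty.mpr hA)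
    rw [Function.mem_fixedPoints_iff, relDerivedSet_apply] at ha
    have hxd : x ∈ derivedSet (CantorBendixson.iteratedDerivedSet (Set.univ : Set X) a) := by
      have := hx
      rw [← ha] at this
      exact this.1
    have hxU : x ∈ U := by
      have : x ∈ U ∩ CantorBendixson.iteratedDerivedSet (Set.univ : Set X) a := by simp [hUA]
      exact this.1
    rw [mem_derivedSet, accPt_iff_nhds] at hxd
    obtain ⟨y, hy, hyx⟩ := hxd U (hU.mem_nhds hxU)
    rw [hUA] at hy
    exact hyx hy
  exact csInf_mem hne

/-- For an infinite scattered compact Hausdorff space, `γ = log_ω CB(X)` satisfies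
`ω ^ γ < CB(X) < ω ^ (γ + 1)`. -/
theorem gammaIndex_spec {X : Type u} [TopologicalSpace X] [CompactSpace X] [T2Space X]
    [Infinite X] (hX : IsScattered X) :
    ∃ γ : Ordinal.{u}, gammaIndex X = Ordinal.omega0 ^ γ ∧
      Ordinal.omega0 ^ γ < cbIndex X ∧ cbIndex X < Ordinal.omega0 ^ (γ + 1) := by
  have hempty := iteratedDerivedSet_cbIndex hX
  have hmin : ∀ ξ < cbIndex X,
      (CantorBendixson.iteratedDerivedSet (Set.univ : Set X) ξ).Nonempty := by
    intro ξ hξ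
    rw [Set.nonempty_iff_ne_empty]
    exact fun h => notMem_of_lt_csInf' hξ h
  have hcl := CantorBendixson.isClosed_iteratedDerivedSet (isClosed_univ : IsClosed (Set.univ : Set X))
  have hanti := CantorBendixson.iteratedDerivedSet_antitone (Set.univ : Set X)
  have h0 : cbIndex X ≠ 0 := by
    intro h
    rw [h, CantorBendixson.iteratedDerivedSet_zero] at hempty
    exact Set.univ_nonempty.ne_empty hempty
  have hlim : ¬ Order.IsSuccLimit (cbIndex X) := by
    intro hl
    have hpos : 0 < cbIndex X := pos_iff_ne_zero.mpr h0
    have : Nonempty (Set.Iio (cbIndex X)) := ⟨⟨0, hpos⟩⟩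
    have hne := IsCompact.nonempty_iInter_of_directed_nonempty_isCompact_isClosed
      (fun b : Set.Iio (cbIndex X) =>
        CantorBendixson.iteratedDerivedSet (Set.univ : Set X) (b : Ordinal.{u}))
      (fun a b => ⟨a ⊔ b, hanti le_sup_left, hanti le_sup_right⟩)
      (fun b => hmin b b.2) (fun b => (hcl b).isCompact) (fun b => hcl b)
    rw [CantorBendixson.iteratedDerivedSet_limit hl] at hempty
    exact hne.ne_empty hempty
  have h1 : cbIndex X ≠ 1 := by
    intro h
    rw [h, ← zero_add (1 : Ordinal.{u}), CantorBendixson.iteratedDerivedSet_succ,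
      CantorBendixson.iteratedDerivedSet_zero, relDerivedSet_apply, Set.inter_univ] at hempty
    have hfin : (Set.univ : Set X).Finite := by
      by_contra hinf
      obtain ⟨x, -, hx⟩ := Set.Infinite.exists_accPt_of_subset_isCompact
        (show (Set.univ : Set X).Infinite from hinf) isCompact_univ subset_rfl
      have : x ∈ derivedSet (Set.univ : Set X) := hx
      rw [hempty] at this
      exact this
    exact Set.infinite_univ hfin
  refine ⟨Ordinal.log Ordinal.omega0 (cbIndex X), ?_, ?_, ?_⟩
  · rw [gammaIndex, if_neg (not_finite_iff_infinite.mpr inferInstance)]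
  · refine lt_of_le_of_ne (Ordinal.opow_log_le_self _ h0) fun h => ?_
    rcases eq_or_ne (Ordinal.log Ordinal.omega0 (cbIndex X)) 0 with hz | hz
    · rw [hz, Ordinal.opow_zero] at h
      exact h1 h.symm
    · apply hlim
      rw [← h]
      exact Ordinal.isSuccLimit_opow_left Ordinal.isSuccLimit_omega0 hz
  · simpa using Ordinal.lt_opow_succ_log_self Ordinal.one_lt_omega0 (cbIndex X)

theorem gammaIndex_unique {X : Type u} [TopologicalSpace X] [Infinite X] {γ : Ordinal.{u}}
    (h₁ : Ordinal.omega0 ^ γ < cbIndex X) (h₂ : cbIndex X < Ordinal.omega0 ^ (γ + 1)) :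
    gammaIndex X = Ordinal.omega0 ^ γ := by
  have h0 : cbIndex X ≠ 0 := (lt_of_le_of_lt zero_le h₁).ne'
  rw [gammaIndex, if_neg (not_finite_iff_infinite.mpr inferInstance)]
  congr 1
  apply le_antisymm
  · have := Ordinal.lt_opow_iff_log_lt Ordinal.one_lt_omega0 h0 |>.mp h₂
    exact Order.lt_add_one_iff.mp this
  · exact (Ordinal.opow_le_iff_le_log Ordinal.one_lt_omega0 h0).mp h₁.le

end CantorBendixsonIndex

section BanachSpaces

variable (𝕜 : Type v) [RCLike 𝕜]

/-- A bounded operator is strictly singular if it is not bounded below on (i.e. not an isomorphism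
from) any infinite-dimensional subspace of its domain. -/
def StrictlySingular {X Y : Type*} [NormedAddCommGroup X] [NormedSpace 𝕜 X]
    [NormedAddCommGroup Y] [NormedSpace 𝕜 Y] (A : X →L[𝕜] Y) : Prop :=
  ∀ W : Submodule 𝕜 X, ¬ FiniteDimensional 𝕜 W →
    ¬ ∃ c : ℝ, 0 < c ∧ ∀ w ∈ W, c * ‖w‖ ≤ ‖A w‖

/-- `X` contains an isomorph of `c₀`: some linear subspace of `X` is linearly homeomorphic to
`c₀`, the Banach space of null sequences with the supremum norm (realized as the continuous
functions vanishing at infinity on the discrete space `ℕ`). -/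
def ContainsC0 (X : Type*) [NormedAddCommGroup X] [NormedSpace 𝕜 X] : Prop :=
  ∃ W : Submodule 𝕜 X, Nonempty (C₀(ℕ, 𝕜) ≃L[𝕜] W)

/-- The projective tensor product of a finite family of normed spaces: the completion of the
algebraic tensor product with respect to the projective (semi)norm. -/
abbrev ProjTensor {n : ℕ} (E : Fin n → Type*) [∀ i, NormedAddCommGroup (E i)]
    [∀ i, NormedSpace 𝕜 (E i)] : Type _ :=
  Completion (⨂[𝕜] i, E i)

/-- The bounded operator between projective tensor products induced by bounded operators between
the factors, i.e. the continuous extension of `⊗ fᵢ ↦ ⊗ gᵢ(fᵢ)`. -/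
def projTensorMap {n : ℕ} {E F : Fin n → Type*} [∀ i, NormedAddCommGroup (E i)]
    [∀ i, NormedSpace 𝕜 (E i)] [∀ i, NormedAddCommGroup (F i)] [∀ i, NormedSpace 𝕜 (F i)]
    (g : ∀ i, E i →L[𝕜] F i) : ProjTensor 𝕜 E →L[𝕜] ProjTensor 𝕜 F :=
  (PiTensorProduct.mapL g).completion

end BanachSpaces

section Restriction

variable (𝕜 : Type v) [RCLike 𝕜]

instance closedsCompactSpace {X : Type u} [TopologicalSpace X] [CompactSpace X]
    (S : Closeds X) : CompactSpace S :=
  isCompact_iff_compactSpace.mp S.isClosed.isCompact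

/-- The restriction operator `f ↦ f|_S` from `C(X)` to `C(S)`, for `S ⊆ X` closed. -/
def restrictToClosed {X : Type u} [TopologicalSpace X] [CompactSpace X] (S : Closeds X) :
    C(X, 𝕜) →L[𝕜] C(S, 𝕜) :=
  LinearMap.mkContinuous
    { toFun := fun f => f.restrict (S : Set X)
      map_add' := fun _ _ => rfl
      map_smul' := fun _ _ => rfl } 1
    (fun f => by
      rw [one_mul]
      exact (ContinuousMap.norm_le _ (norm_nonneg f)).2 fun x => f.norm_coe_le_norm x)

variable {n : ℕ} (K : Fin n → Type u) [∀ i, TopologicalSpace (K i)] [∀ i, CompactSpace (K i)]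

/-- The family of closed sets `L_i ⊆ K_i` with `L_m = S` and `L_i = K_i` (the whole space) for
`i ≠ m`. -/
def factorSets (m : Fin n) (S : Closeds (K m)) : ∀ i, Closeds (K i) :=
  Function.update (fun _ => ⊤) m S

/-- The operator `Q^m_S` on the projective tensor product of the `C(K_i)`: the continuous extension
of `⊗ f_i ↦ ⊗ g_i` with `g_i = f_i` for `i ≠ m` and `g_m = f_m|_S`. Its codomain is the projective
tensor product in which the `m`-th factor `C(K_m)` is replaced by `C(S)`; for `i ≠ m`, the space
`K_i` is regarded as a closed subset of itself. If `S = ∅` the codomain is the zero space. -/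
def restrictOp (m : Fin n) (S : Closeds (K m)) :
    ProjTensor 𝕜 (fun i => C(K i, 𝕜)) →L[𝕜] ProjTensor 𝕜 (fun i => C(factorSets K m S i, 𝕜)) :=
  projTensorMap 𝕜 (fun i => restrictToClosed 𝕜 (factorSets K m S i))

theorem restrictOp_tprod (m : Fin n) (S : Closeds (K m)) (f : ∀ i, C(K i, 𝕜)) :
    restrictOp 𝕜 K m S ((⨂ₜ[𝕜] i, f i : ⨂[𝕜] i, C(K i, 𝕜))) =
      ((⨂ₜ[𝕜] i, (f i).restrict (factorSets K m S i : Set (K i)) :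
        ⨂[𝕜] i, C(factorSets K m S i, 𝕜))) := by
  simp only [restrictOp, projTensorMap]
  erw [ContinuousLinearMap.completion_apply_coe]
  simp
  rfl

end Restriction

end ProjTensorCK

end

/-! The projective tensor product of the spaces C(K_i) is c₀-saturated because the K_i are
scattered. The argument is a gliding hump around one point p_m in each factor.

Call an operator singular on Z if it is bounded below on no infinite-dimensional subspace of Z. In
coordinate m, consider the points without a clopen neighbourhood whose indicator multiplies
singularly on Z. By compactness this set is non-empty, since otherwise the identity would be
singular. Scatteredness gives it an isolated point p_m. Multiplying by a small clopen neighbourhood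
of p_m, and then evaluating at p_m if that is not singular either, replaces Z by an isomorphic image
of a subspace. There, either every element is constant in coordinate m, or both evaluation at p_m
and multiplication by any clopen set missing p_m are singular (`exists_concentratedAt`). Operators
in different coordinates commute, so the coordinates can be treated one after another.

Let A be the set of non-constant coordinates. If A is empty, Z lies in a line, which is impossible.
Otherwise Kato's theorem (`SingularOn.exists_norm_le`) makes finitely many singular operators small
at once. A unit vector found this way is almost supported, in each coordinate of A, on a clopen set
that misses p_m and all earlier supports (`exists_near_block`). Iteration gives unit vectors close
to blocks with disjoint supports in every coordinate of A.

The upper c₀-estimate for such blocks is `norm_sum_block_le`. By duality it reduces to bounding the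
diagonal sum of a multilinear form, where averaging over signs removes the off-diagonal terms
(`norm_sum_diagonal_le`). The block projections give the lower estimate. -/

noncomputable section

open TopologicalSpace UniformSpace Filter
open scoped TensorProduct ZeroAtInfty Topology

namespace ProjTensorCK

/-! ### Operators singular on a subspace, and Kato's theorem. -/

section SingularOn

variable {𝕜 : Type*} [RCLike 𝕜]
variable {X Y : Type*} [NormedAddCommGroup X] [NormedSpace 𝕜 X] [NormedAddCommGroup Y]
  [NormedSpace 𝕜 Y]

/-- `R` is not bounded below on any infinite-dimensional subspace of `Z`. -/
def SingularOn (R : X →L[𝕜] Y) (Z : Submodule 𝕜 X) : Prop :=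
  ∀ W ≤ Z, ¬ FiniteDimensional 𝕜 W → ¬ ∃ c : ℝ, 0 < c ∧ ∀ w ∈ W, c * ‖w‖ ≤ ‖R w‖

theorem SingularOn.mono {R : X →L[𝕜] Y} {Z Z' : Submodule 𝕜 X} (h : SingularOn R Z)
    (hZ : Z' ≤ Z) : SingularOn R Z' :=
  fun W hW => h W (hW.trans hZ)

theorem SingularOn.congr {R R' : X →L[𝕜] Y} {Z : Submodule 𝕜 X} (h : SingularOn R Z)
    (hR : ∀ z ∈ Z, R z = R' z) : SingularOn R' Z := by
  rintro W hW hinf ⟨c, hc, hb⟩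
  exact h W hW hinf ⟨c, hc, fun w hw => by rw [hR w (hW hw)]; exact hb w hw⟩

theorem SingularOn.of_norm_le {R R' : X →L[𝕜] Y} {Z : Submodule 𝕜 X} (h : SingularOn R Z)
    (hR : ∀ z ∈ Z, ‖R' z‖ ≤ ‖R z‖) : SingularOn R' Z := by
  rintro W hW hinf ⟨c, hc, hb⟩
  exact h W hW hinf ⟨c, hc, fun w hw => (hb w hw).trans (hR w (hW hw))⟩

theorem singularOn_zero (Z : Submodule 𝕜 X) : SingularOn (0 : X →L[𝕜] Y) Z := by
  rintro W - hW ⟨c, hc, hb⟩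
  apply hW
  have : W = ⊥ := by
    rw [Submodule.eq_bot_iff]
    intro w hw
    have := hb w hw
    simp only [zero_apply, norm_zero] at this
    exact norm_le_zero_iff.mp (nonpos_of_mul_nonpos_right this hc)
  rw [this]
  infer_instance

theorem not_finiteDimensional_inf_ker {W : Submodule 𝕜 X} (hW : ¬ FiniteDimensional 𝕜 W)
    (f : X →L[𝕜] 𝕜) : ¬ FiniteDimensional 𝕜 (W ⊓ f.ker : Submodule 𝕜 X) := by
  intro h
  apply hW
  rw [FiniteDimensional, Module.finite_def, Submodule.fg_top] at h ⊢
  refine Submodule.fg_of_fg_map_of_fg_inf_ker (f : X →ₗ[𝕜] 𝕜) ?_ h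
  exact IsNoetherian.noetherian _

/-- Each kernel costs at most one dimension. This is what lets later vectors be chosen annihilated
by all earlier functionals. -/
theorem not_finiteDimensional_inf_iInf_ker {W : Submodule 𝕜 X} (hW : ¬ FiniteDimensional 𝕜 W)
    {α : Type*} (f : α → X →L[𝕜] 𝕜) (s : Finset α) :
    ∃ W' ≤ W, ¬ FiniteDimensional 𝕜 W' ∧ ∀ a ∈ s, ∀ w ∈ W', f a w = 0 := by
  classical
  induction s using Finset.induction_on with
  | empty => exact ⟨W, le_rfl, hW, by simp⟩
  | insert a s _ ih =>
    obtain ⟨W', hW', hinf, h0⟩ := ih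
    refine ⟨W' ⊓ (f a).ker, inf_le_left.trans hW', not_finiteDimensional_inf_ker hinf _, ?_⟩
    intro b hb w hw
    rcases Finset.mem_insert.mp hb with rfl | hb
    · exact hw.2
    · exact h0 b hb w hw.1

theorem SingularOn.exists_norm_lt {R : X →L[𝕜] Y} {Z : Submodule 𝕜 X} (h : SingularOn R Z)
    (hZ : ¬ FiniteDimensional 𝕜 Z) {ε : ℝ} (hε : 0 < ε) :
    ∃ z ∈ Z, ‖z‖ = 1 ∧ ‖R z‖ < ε := by
  have := h Z le_rfl hZ
  push Not at this
  obtain ⟨w, hw, hlt⟩ := this ε hε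
  have hw0 : 0 < ‖w‖ := by
    rw [norm_pos_iff]
    rintro rfl
    simp at hlt
  refine ⟨((‖w‖ : 𝕜)⁻¹) • w, Z.smul_mem _ hw, ?_, ?_⟩
  · rw [norm_smul, norm_inv, RCLike.norm_ofReal, abs_norm, inv_mul_cancel₀ hw0.ne']
  · rw [map_smul, norm_smul, norm_inv, RCLike.norm_ofReal, abs_norm, inv_mul_lt_iff₀ hw0]
    linarith

/-- A triangular system of norm-one vectors and functionals controls coefficients. -/
theorem norm_coeff_le_of_triangular {z : ℕ → X} {f : ℕ → X →L[𝕜] 𝕜} (hz : ∀ k, ‖z k‖ = 1)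
    (hf : ∀ k, ‖f k‖ ≤ 1) (hfz : ∀ k, f k (z k) = 1) (h0 : ∀ k m, k < m → f k (z m) = 0)
    (l : ℕ →₀ 𝕜) (k : ℕ) : ‖l k‖ ≤ 2 ^ k * ‖Finsupp.linearCombination 𝕜 z l‖ := by
  set w := Finsupp.linearCombination 𝕜 z l with hw
  induction k using Nat.strong_induction_on with
  | _ k ih =>
    have hsub : l.support ⊆ Finset.range (l.support.sup id + k + 1) := by
      intro i hi
      have := Finset.le_sup (f := id) hi
      simp only [id] at this
      simp
      omega
    have e1 : f k w = ∑ i ∈ Finset.range (l.support.sup id + k + 1), l i * f k (z i) := by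
      rw [hw, Finsupp.linearCombination_apply, Finsupp.sum_of_support_subset _ hsub _ (by simp)]
      simp
    have e2 : f k w = ∑ i ∈ Finset.range (k + 1), l i * f k (z i) := by
      rw [e1]
      symm
      apply Finset.sum_subset
      · intro i hi
        simp at hi ⊢
        omega
      · intro i _ hi
        rw [h0 k i (by simpa using hi), mul_zero]
    rw [Finset.sum_range_succ, hfz, mul_one] at e2
    have e3 : l k = f k w - ∑ i ∈ Finset.range k, l i * f k (z i) := by rw [e2]; ring
    have hfle : ∀ x, ‖f k x‖ ≤ ‖x‖ := fun x => (f k).le_of_opNorm_le (hf k) x |>.trans (by simp)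
    calc ‖l k‖ ≤ ‖f k w‖ + ‖∑ i ∈ Finset.range k, l i * f k (z i)‖ := by
          rw [e3]; exact norm_sub_le _ _
      _ ≤ ‖w‖ + ∑ i ∈ Finset.range k, 2 ^ i * ‖w‖ := by
          gcongr
          · exact hfle w
          · refine norm_sum_le_of_le _ fun i hi => ?_
            rw [norm_mul]
            have := hfle (z i)
            rw [hz] at this
            calc ‖l i‖ * ‖f k (z i)‖ ≤ ‖l i‖ * 1 := by gcongr
              _ ≤ _ := by rw [mul_one]; exact ih i (Finset.mem_range.mp hi)
      -- The constant 2 ^ k solves the recursion: 1 + (1 + 2 + ... + 2 ^ (k - 1)) = 2 ^ k.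
      _ = 2 ^ k * ‖w‖ := by
          rw [← Finset.sum_mul, geom_sum_eq (by norm_num)]
          ring

/-- Kato: an operator that is singular on `Z` has arbitrarily small norm on some
infinite-dimensional subspace of `Z`. -/
theorem SingularOn.exists_norm_le {R : X →L[𝕜] Y} {Z : Submodule 𝕜 X} (h : SingularOn R Z)
    (hZ : ¬ FiniteDimensional 𝕜 Z) {ε : ℝ} (hε : 0 < ε) :
    ∃ W ≤ Z, ¬ FiniteDimensional 𝕜 W ∧ ∀ w ∈ W, ‖R w‖ ≤ ε * ‖w‖ := by
  classical
  -- The terms are triples (δ, z, f): a unit vector z with ‖R z‖ ≤ δ and a functional f norming z.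
  -- Dividing δ by 4 each time beats the growth 2 ^ k of the coefficient bounds.
  obtain ⟨u, hP, hr⟩ := exists_seq_of_forall_finset_exists
    (fun a : ℝ × X × (X →L[𝕜] 𝕜) => 0 < a.1 ∧ a.1 ≤ ε / 2 ∧ a.2.1 ∈ Z ∧ ‖a.2.1‖ = 1 ∧
      ‖a.2.2‖ ≤ 1 ∧ a.2.2 a.2.1 = 1 ∧ ‖R a.2.1‖ ≤ a.1)
    (fun a b => b.1 ≤ a.1 / 4 ∧ a.2.2 b.2.1 = 0) (by
      intro s hs
      obtain ⟨W, hWZ, hW, hker⟩ := not_finiteDimensional_inf_iInf_ker hZ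
        (fun a : ℝ × X × (X →L[𝕜] 𝕜) => a.2.2) s
      obtain ⟨δ, hδ, hδε, hδs⟩ : ∃ δ : ℝ, 0 < δ ∧ δ ≤ ε / 2 ∧ ∀ a ∈ s, δ ≤ a.1 / 4 := by
        clear hker
        induction s using Finset.induction_on with
        | empty => exact ⟨ε / 2, by positivity, le_rfl, by simp⟩
        | insert a s _ ih =>
          obtain ⟨δ, h1, h2, h3⟩ := ih fun x hx => hs x (Finset.mem_insert_of_mem hx)
          have := (hs a (Finset.mem_insert_self _ _)).1
          refine ⟨min δ (a.1 / 4), by positivity, (min_le_left _ _).trans h2, ?_⟩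
          intro b hb
          rcases Finset.mem_insert.mp hb with rfl | hb
          · exact min_le_right _ _
          · exact (min_le_left _ _).trans (h3 b hb)
      obtain ⟨z, hz, hz1, hRz⟩ := (h.mono hWZ).exists_norm_lt hW hδ
      obtain ⟨f, hf, hfz⟩ := exists_dual_vector 𝕜 z (by simp [hz1])
      refine ⟨(δ, z, f), ⟨hδ, hδε, hWZ hz, hz1, hf.le, ?_, hRz.le⟩,
        fun a ha => ⟨hδs a ha, hker a ha z hz⟩⟩
      simp [hfz, hz1])
  set z := fun k => (u k).2.1 with hzdef
  have hcoef := norm_coeff_le_of_triangular (z := z) (f := fun k => (u k).2.2)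
    (fun k => (hP k).2.2.2.1) (fun k => (hP k).2.2.2.2.1) (fun k => (hP k).2.2.2.2.2.1)
    (fun k m hkm => (hr k m hkm).2)
  have hδ : ∀ k, (u k).1 ≤ ε / 2 * (1 / 4) ^ k := by
    intro k
    induction k with
    | zero => simpa using (hP 0).2.1
    | succ k ih =>
      have := (hr k (k + 1) (Nat.lt_succ_self k)).1
      rw [pow_succ]
      linarith
  refine ⟨Submodule.span 𝕜 (Set.range z), ?_, ?_, ?_⟩
  · rw [Submodule.span_le]
    rintro _ ⟨k, rfl⟩
    exact (hP k).2.2.1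
  · intro hfin
    have hli : LinearIndependent 𝕜 z := by
      rw [linearIndependent_iff]
      intro l hl
      ext k
      have := hcoef l k
      rw [hl] at this
      simpa using this
    have hli' := LinearIndependent.of_comp (Submodule.span 𝕜 (Set.range z)).subtype
      (v := fun k => ⟨z k, Submodule.subset_span ⟨k, rfl⟩⟩) hli
    exact Set.infinite_univ (α := ℕ) (Set.finite_univ_iff.mpr hli'.finite)
  · intro w hw
    obtain ⟨l, rfl⟩ := (Finsupp.mem_span_range_iff_exists_finsupp).mp hw
    change ‖R (Finsupp.linearCombination 𝕜 z l)‖ ≤ ε * ‖Finsupp.linearCombination 𝕜 z l‖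
    set w := Finsupp.linearCombination 𝕜 z l with hwdef
    have hsub : l.support ⊆ Finset.range (l.support.sup id + 1) := by
      intro i hi
      have := Finset.le_sup (f := id) hi
      simp only [id] at this
      simp
      omega
    have e1 : R w = ∑ i ∈ Finset.range (l.support.sup id + 1), l i • R (z i) := by
      rw [hwdef, Finsupp.linearCombination_apply, Finsupp.sum_of_support_subset _ hsub _ (by simp)]
      simp
    rw [e1]
    calc ‖∑ i ∈ Finset.range (l.support.sup id + 1), l i • R (z i)‖
        ≤ ∑ i ∈ Finset.range (l.support.sup id + 1), ε / 2 * ‖w‖ * (1 / 2) ^ i := by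
          refine norm_sum_le_of_le _ fun i _ => ?_
          rw [norm_smul]
          calc ‖l i‖ * ‖R (z i)‖ ≤ (2 ^ i * ‖w‖) * (ε / 2 * (1 / 4) ^ i) := by
                gcongr
                · exact hcoef l i
                · exact (hP i).2.2.2.2.2.2.trans (hδ i)
            _ = ε / 2 * ‖w‖ * (2 ^ i * (1 / 4) ^ i) := by ring
            _ = _ := by rw [← mul_pow]; norm_num
      _ = ε / 2 * ‖w‖ * ∑ i ∈ Finset.range (l.support.sup id + 1), (1 / 2 : ℝ) ^ i := by
          rw [Finset.mul_sum]
      _ ≤ ε / 2 * ‖w‖ * 2 := by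
          gcongr
          exact sum_geometric_two_le _
      _ = ε * ‖w‖ := by ring

/-- Kato's theorem can be applied successively, because singularity passes to smaller subspaces. -/
theorem exists_subspace_norm_le {Z : Submodule 𝕜 X} (hZ : ¬ FiniteDimensional 𝕜 Z) {α : Type*}
    (R : α → X →L[𝕜] Y) (s : Finset α) (h : ∀ a ∈ s, SingularOn (R a) Z) {ε : ℝ} (hε : 0 < ε) :
    ∃ W ≤ Z, ¬ FiniteDimensional 𝕜 W ∧ ∀ a ∈ s, ∀ w ∈ W, ‖R a w‖ ≤ ε * ‖w‖ := by
  classical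
  induction s using Finset.induction_on with
  | empty => exact ⟨Z, le_rfl, hZ, by simp⟩
  | insert a s _ ih =>
    obtain ⟨W', hW', hinf, h0⟩ := ih fun x hx => h x (Finset.mem_insert_of_mem hx)
    obtain ⟨W, hW, hWinf, hb⟩ :=
      ((h a (Finset.mem_insert_self _ _)).mono hW').exists_norm_le hinf hε
    refine ⟨W, hW.trans hW', hWinf, ?_⟩
    intro b hb' w hw
    rcases Finset.mem_insert.mp hb' with rfl | hb'
    · exact hb w hw
    · exact h0 b hb' w (hW hw)

/-- If T were bounded below by c, Kato's theorem would give a subspace where R is at most c / 2,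
leaving S bounded below by c / 2 there. -/
theorem SingularOn.of_norm_le_add {R S T : X →L[𝕜] Y} {Z : Submodule 𝕜 X} (hR : SingularOn R Z)
    (hS : SingularOn S Z) (hT : ∀ z, ‖T z‖ ≤ ‖R z‖ + ‖S z‖) : SingularOn T Z := by
  rintro W hW hinf ⟨c, hc, hb⟩
  obtain ⟨V, hVW, hV, hRV⟩ := (hR.mono hW).exists_norm_le hinf (half_pos hc)
  refine hS V (hVW.trans hW) hV ⟨c / 2, half_pos hc, fun v hv => ?_⟩
  have := hRV v hv
  have := hb v (hVW hv)
  have := hT v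
  linarith

end SingularOn

/-! ### Criteria for containing c₀, and transfer along operators that are not singular. -/

section ContainsC0

variable {𝕜 : Type*} [RCLike 𝕜]
variable {X Y : Type*} [NormedAddCommGroup X] [NormedSpace 𝕜 X] [NormedAddCommGroup Y]
  [NormedSpace 𝕜 Y]

theorem containsC0_of_bounded_below [CompleteSpace X] (T : C₀(ℕ, 𝕜) →L[𝕜] X) {c : ℝ} (hc : 0 < c)
    (hT : ∀ a, c * ‖a‖ ≤ ‖T a‖) : ContainsC0 𝕜 X := by
  have hanti : AntilipschitzWith (Real.toNNReal c⁻¹) T := by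
    refine AddMonoidHomClass.antilipschitz_of_bound T fun a => ?_
    rw [Real.coe_toNNReal _ (by positivity), ← div_eq_inv_mul, le_div_iff₀ hc]
    linarith [hT a]
  have hcl : IsClosed (Set.range T) := hanti.isClosed_range T.uniformContinuous
  exact ⟨T.range, ⟨T.equivRange hanti.injective hcl⟩⟩

theorem ContainsC0.map (h : ContainsC0 𝕜 X) [CompleteSpace Y] (T : X →L[𝕜] Y) {c : ℝ} (hc : 0 < c)
    (hT : ∀ x, c * ‖x‖ ≤ ‖T x‖) : ContainsC0 𝕜 Y := by
  obtain ⟨W, ⟨e⟩⟩ := h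
  obtain ⟨d, hd, he⟩ : ∃ d : ℝ, 0 < d ∧ ∀ a, d * ‖a‖ ≤ ‖e a‖ := by
    refine ⟨(‖(e.symm : W →L[𝕜] C₀(ℕ, 𝕜))‖ + 1)⁻¹, by positivity, fun a => ?_⟩
    rw [inv_mul_le_iff₀ (by positivity)]
    have := (e.symm : W →L[𝕜] C₀(ℕ, 𝕜)).le_opNorm (e a)
    simp only [ContinuousLinearEquiv.coe_coe, ContinuousLinearEquiv.symm_apply_apply] at this
    nlinarith [norm_nonneg (e a)]
  refine containsC0_of_bounded_below (T ∘L W.subtypeL ∘L (e : C₀(ℕ, 𝕜) →L[𝕜] W))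
    (mul_pos hc hd) fun a => ?_
  calc c * d * ‖a‖ = c * (d * ‖a‖) := by ring
    _ ≤ c * ‖e a‖ := by gcongr; exact he a
    _ ≤ _ := hT (e a)

/-- A sequence equivalent to the unit vector basis of `c₀`, estimated on finite sums. -/
theorem containsC0_of_sequence [CompleteSpace X] (z : ℕ → X) {c C : ℝ} (hc : 0 < c) (hC : 0 ≤ C)
    (hup : ∀ (F : Finset ℕ) (a : ℕ → 𝕜) (M : ℝ), 0 ≤ M → (∀ j ∈ F, ‖a j‖ ≤ M) →
      ‖∑ j ∈ F, a j • z j‖ ≤ C * M)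
    (hlow : ∀ (F : Finset ℕ) (a : ℕ → 𝕜), ∀ k ∈ F, c * ‖a k‖ ≤ ‖∑ j ∈ F, a j • z j‖) :
    ContainsC0 𝕜 X := by
  -- Only finitely many coefficients of a null sequence exceed ε / (C + 1), so the upper estimate is
  -- the Cauchy criterion.
  have hsum : ∀ a : C₀(ℕ, 𝕜), Summable fun j => a j • z j := by
    intro a
    rw [summable_iff_vanishing_norm]
    intro ε hε
    have hlim : Tendsto a cofinite (𝓝 0) := by
      have := a.zero_at_infty'
      rwa [cocompact_eq_cofinite] at this
    have hδ : 0 < ε / (C + 1) := by positivity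
    have hfin : {j | ¬ ‖a j‖ ≤ ε / (C + 1)}.Finite := by
      have := (tendsto_zero_iff_norm_tendsto_zero.mp hlim).eventually (ge_mem_nhds hδ)
      exact this
    refine ⟨hfin.toFinset, fun t ht => ?_⟩
    refine (hup t a (ε / (C + 1)) hδ.le fun j hj => ?_).trans_lt ?_
    · by_contra hcon
      exact Finset.disjoint_left.mp ht hj (by simpa using hcon)
    · rw [mul_div_assoc', div_lt_iff₀ (by positivity)]
      nlinarith
  have hle : ∀ (a : C₀(ℕ, 𝕜)) (j : ℕ), ‖a j‖ ≤ ‖a‖ := fun a j => by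
    rw [← ZeroAtInftyContinuousMap.norm_toBCF_eq_norm]
    exact a.toBCF.norm_coe_le_norm j
  let T : C₀(ℕ, 𝕜) →L[𝕜] X := LinearMap.mkContinuous
    { toFun := fun a => ∑' j, a j • z j
      map_add' := fun a b => by
        rw [← (hsum a).tsum_add (hsum b)]
        simp [add_smul]
      map_smul' := fun r a => by
        rw [RingHom.id_apply, ← (hsum a).tsum_const_smul]
        simp [mul_smul] } C (fun a => by
      refine le_of_tendsto ((hsum a).hasSum.norm) (Eventually.of_forall fun F => ?_)
      exact hup F a ‖a‖ (norm_nonneg _) fun j _ => hle a j)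
  refine containsC0_of_bounded_below T hc fun a => ?_
  have hk : ∀ k, c * ‖a k‖ ≤ ‖T a‖ := by
    intro k
    refine ge_of_tendsto ((hsum a).hasSum.norm) ?_
    filter_upwards [eventually_ge_atTop {k}] with F hF
    exact hlow F a k (hF (Finset.mem_singleton_self k))
  rw [mul_comm, ← le_div_iff₀ hc, ← ZeroAtInftyContinuousMap.norm_toBCF_eq_norm,
    BoundedContinuousFunction.norm_le (by positivity)]
  intro k
  rw [le_div_iff₀ hc, mul_comm]
  exact hk k

/-- A normalized sequence that is a small perturbation of a block sequence `B j (z j)`, where the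
`B j` are mutually annihilating contractive projections with an upper `c₀`-estimate. -/
theorem containsC0_of_blocks [CompleteSpace X] (Z : Submodule 𝕜 X)
    (hZ : IsClosed (Z : Set X)) (z : ℕ → X) (B : ℕ → X →L[𝕜] X) (δ : ℕ → ℝ) (hzZ : ∀ j, z j ∈ Z)
    (hz : ∀ j, ‖z j‖ = 1) (hB1 : ∀ j x, ‖B j x‖ ≤ ‖x‖) (hBB : ∀ j x, B j (B j x) = B j x)
    (hB0 : ∀ j k, j ≠ k → ∀ x, B j (B k x) = 0)
    (hup : ∀ (F : Finset ℕ) (x : ℕ → X) (M : ℝ), 0 ≤ M → (∀ j ∈ F, ‖x j‖ ≤ M) →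
      ‖∑ j ∈ F, B j (x j)‖ ≤ M)
    (hδ : ∀ j, ‖z j - B j (z j)‖ ≤ δ j) (hδsum : ∀ F : Finset ℕ, ∑ j ∈ F, δ j ≤ 1 / 4) :
    ContainsC0 𝕜 Z := by
  have : CompleteSpace Z := hZ.completeSpace_coe
  have hpert : ∀ (F : Finset ℕ) (a : ℕ → 𝕜) (M : ℝ), 0 ≤ M → (∀ j ∈ F, ‖a j‖ ≤ M) →
      ‖∑ j ∈ F, a j • z j - ∑ j ∈ F, B j (a j • z j)‖ ≤ 1 / 4 * M := by
    intro F a M hM ha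
    rw [← Finset.sum_sub_distrib]
    calc ‖∑ j ∈ F, (a j • z j - B j (a j • z j))‖ ≤ ∑ j ∈ F, δ j * M := by
          refine norm_sum_le_of_le _ fun j hj => ?_
          rw [map_smul, ← smul_sub, norm_smul, mul_comm]
          exact mul_le_mul (hδ j) (ha j hj) (norm_nonneg _) ((norm_nonneg _).trans (hδ j))
      _ = (∑ j ∈ F, δ j) * M := by rw [Finset.sum_mul]
      _ ≤ 1 / 4 * M := by gcongr; exact hδsum F
  have hcoe : ∀ (F : Finset ℕ) (a : ℕ → 𝕜),
      ‖∑ j ∈ F, a j • (⟨z j, hzZ j⟩ : Z)‖ = ‖∑ j ∈ F, a j • z j‖ := by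
    intro F a
    rw [Submodule.coe_norm]
    simp
  -- The perturbation costs 1 / 4: C = 1 + 1 / 4, and c = 3 / 4 - 1 / 4, where 3 / 4 bounds ‖B m (z
  -- m)‖ from below.
  refine containsC0_of_sequence (fun j => (⟨z j, hzZ j⟩ : Z)) (c := 1 / 2) (C := 5 / 4)
    (by norm_num) (by norm_num) ?_ ?_
  · intro F a M hM ha
    rw [hcoe]
    have h1 := hpert F a M hM ha
    have h2 := hup F (fun j => a j • z j) M hM fun j hj => by
      rw [norm_smul, hz, mul_one]; exact ha j hj
    have h3 := norm_le_norm_add_norm_sub' (∑ j ∈ F, a j • z j) (∑ j ∈ F, B j (a j • z j))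
    linarith
  · intro F a k hk
    rw [hcoe]
    -- The largest coefficient controls the perturbation error, and B m isolates it from the block
    -- sum.
    obtain ⟨m, hm, hmax⟩ := F.exists_max_image (fun j => ‖a j‖) ⟨k, hk⟩
    have h1 := hpert F a ‖a m‖ (norm_nonneg _) hmax
    have h2 : B m (∑ j ∈ F, B j (a j • z j)) = a m • B m (z m) := by
      rw [map_sum, Finset.sum_eq_single m]
      · rw [hBB, map_smul]
      · exact fun j _ hj => hB0 m j hj.symm _
      · exact fun h => absurd hm h
    have h3 := hB1 m (∑ j ∈ F, B j (a j • z j))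
    rw [h2, norm_smul] at h3
    have h4 : 3 / 4 ≤ ‖B m (z m)‖ := by
      have h5 := hδ m
      have h6 := hδsum {m}
      rw [Finset.sum_singleton] at h6
      have h7 := norm_sub_norm_le (z m) (B m (z m))
      rw [hz] at h7
      linarith
    have h8 := norm_sub_norm_le (∑ j ∈ F, B j (a j • z j)) (∑ j ∈ F, a j • z j)
    rw [norm_sub_rev] at h8
    have h9 := hmax k hk
    have h10 := mul_le_mul_of_nonneg_left h4 (norm_nonneg (a m))
    linarith

/-- If `T` is not singular on the closed subspace `Z`, then it maps some infinite-dimensional closed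
subspace of `Z` isomorphically onto a closed subspace, which inherits the singularity of the
operators that commute with `T`. -/
theorem exists_image_of_not_singularOn [CompleteSpace X] {Z : Submodule 𝕜 X}
    (hZ : IsClosed (Z : Set X)) {T : X →L[𝕜] X} (hT : ¬ SingularOn T Z) :
    ∃ Z' : Submodule 𝕜 X, IsClosed (Z' : Set X) ∧ ¬ FiniteDimensional 𝕜 Z' ∧
      (ContainsC0 𝕜 Z' → ContainsC0 𝕜 Z) ∧ (∀ z ∈ Z', ∃ w ∈ Z, z = T w) ∧
      ∀ R : X →L[𝕜] X, Commute R T → SingularOn R Z → SingularOn R Z' := by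
  have hZc : CompleteSpace Z := hZ.completeSpace_coe
  unfold SingularOn at hT
  push Not at hT
  obtain ⟨W₀, hW₀, hinf₀, c, hc, hb₀⟩ := hT
  -- The lower bound extends to the closure, whose completeness makes the image closed.
  set W := W₀.topologicalClosure with hWdef
  have hWZ : W ≤ Z := W₀.topologicalClosure_minimal hW₀ hZ
  have hWcl : IsClosed (W : Set X) := W₀.isClosed_topologicalClosure
  have hWc : CompleteSpace W := hWcl.completeSpace_coe
  have hinf : ¬ FiniteDimensional 𝕜 W := fun h =>
    hinf₀ (Submodule.finiteDimensional_of_le W₀.le_topologicalClosure)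
  have hb : ∀ w ∈ W, c * ‖w‖ ≤ ‖T w‖ := by
    intro w hw
    have hclosed : IsClosed {w | c * ‖w‖ ≤ ‖T w‖} :=
      isClosed_le (by fun_prop) (by fun_prop)
    exact closure_minimal (fun x hx => hb₀ x hx) hclosed hw
  let TW : W →L[𝕜] X := T ∘L W.subtypeL
  have hanti : AntilipschitzWith (Real.toNNReal c⁻¹) TW := by
    refine AddMonoidHomClass.antilipschitz_of_bound TW fun a => ?_
    rw [Real.coe_toNNReal _ (by positivity), ← div_eq_inv_mul, le_div_iff₀ hc, mul_comm]
    exact hb a a.2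
  have hcl : IsClosed (Set.range TW) := hanti.isClosed_range TW.uniformContinuous
  let e : W ≃L[𝕜] TW.range := TW.equivRange hanti.injective hcl
  have he : ∀ y : TW.range, T (e.symm y : X) = y := fun y => by
    have : ((e (e.symm y) : TW.range) : X) = T (e.symm y : X) := rfl
    rw [← this, e.apply_symm_apply]
  refine ⟨TW.range, hcl, ?_, ?_, ?_, ?_⟩
  · intro hfin
    exact hinf (e.symm.toLinearEquiv.finiteDimensional)
  · intro h0
    let f : TW.range →L[𝕜] Z := (W.subtypeL ∘L (e.symm : TW.range →L[𝕜] W)).codRestrict Z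
      fun y => hWZ (e.symm y).2
    refine h0.map f (c := (‖T‖ + 1)⁻¹) (by positivity) fun y => ?_
    rw [inv_mul_le_iff₀ (by positivity)]
    have h1 := T.le_opNorm (e.symm y : X)
    rw [he] at h1
    change ‖(y : X)‖ ≤ (‖T‖ + 1) * ‖(e.symm y : X)‖
    nlinarith [norm_nonneg (e.symm y : X)]
  · rintro _ ⟨w, rfl⟩
    exact ⟨w, hWZ w.2, rfl⟩
  · rintro R hcomm hR V hV hVinf ⟨d, hd, hRV⟩
    -- T maps this preimage onto V. On it, d c ‖w‖ ≤ d ‖T w‖ ≤ ‖R T w‖ = ‖T R w‖ ≤ ‖T‖ ‖R w‖, so R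
    -- would be bounded below on a subspace of Z.
    have hU : ¬ FiniteDimensional 𝕜 (W ⊓ V.comap (T : X →ₗ[𝕜] X) : Submodule 𝕜 X) := by
      intro hfin
      apply hVinf
      have hmap : (W ⊓ V.comap (T : X →ₗ[𝕜] X) : Submodule 𝕜 X).map (T : X →ₗ[𝕜] X) = V := by
        apply le_antisymm
        · rintro _ ⟨w, hw, rfl⟩
          exact hw.2
        · intro v hv
          obtain ⟨w, hw⟩ := hV hv
          refine ⟨w, ⟨w.2, ?_⟩, hw⟩
          change T w ∈ V
          rw [show T w = v from hw]
          exact hv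
      rw [← hmap]
      infer_instance
    refine hR _ (inf_le_left.trans hWZ) hU ⟨d * c / (‖T‖ + 1), by positivity, fun w hw => ?_⟩
    have h1 := hRV (T w) hw.2
    have h2 : R (T w) = T (R w) := DFunLike.congr_fun hcomm.eq w
    have h3 := T.le_opNorm (R w)
    have h4 := hb w hw.1
    rw [h2] at h1
    rw [div_mul_eq_mul_div, div_le_iff₀ (by positivity)]
    nlinarith [norm_nonneg (R w), norm_nonneg T]

end ContainsC0

/-! ### Random signs and the diagonal of a multilinear form. -/

section SignAveraging

variable {𝕜 : Type*} [RCLike 𝕜]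

theorem sum_sign_mul_sign {J : Type*} [Fintype J] [DecidableEq J] (j k : J) :
    ∑ r : J → ℤˣ, (((r j : ℤ) : 𝕜) * ((r k : ℤ) : 𝕜)) =
      if j = k then (Fintype.card (J → ℤˣ) : 𝕜) else 0 := by
  split_ifs with h
  · subst h
    have : ∀ r : J → ℤˣ, (((r j : ℤ) : 𝕜) * ((r j : ℤ) : 𝕜)) = 1 := fun r => by
      rw [← Int.cast_mul, ← Units.val_mul, Int.units_mul_self]
      simp
    simp [this]
  -- Flipping the j-th sign permutes the sign vectors and negates each summand, so the sum equals
  -- its own negative.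
  · have key := Fintype.sum_equiv (Equiv.mulRight (Pi.mulSingle j (-1) : J → ℤˣ))
      (fun r : J → ℤˣ => -(((r j : ℤ) : 𝕜) * ((r k : ℤ) : 𝕜)))
      (fun r : J → ℤˣ => (((r j : ℤ) : 𝕜) * ((r k : ℤ) : 𝕜))) (fun r => by
        simp [Pi.mulSingle_eq_of_ne (Ne.symm h)])
    rw [Finset.sum_neg_distrib] at key
    exact self_eq_neg.mp key.symm

variable {ι : Type*} [DecidableEq ι] {E : ι → Type*} [∀ i, NormedAddCommGroup (E i)]
  [∀ i, NormedSpace 𝕜 (E i)]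

/-- Diagonal estimate for a multilinear form: families that are `c₀`-like in the coordinates of a
non-empty set `A` and constant in the remaining ones. -/
theorem norm_sum_diagonal_le {J : Type*} [Fintype J] [DecidableEq J] (Φ : MultilinearMap 𝕜 E 𝕜)
    {C : ℝ} (hΦ : ∀ v, (∀ i, ‖v i‖ ≤ 1) → ‖Φ v‖ ≤ C) (A : Finset ι) (hA : A.Nonempty)
    (g : J → ∀ i, E i)
    (hgA : ∀ i ∈ A, ∀ t : J → 𝕜, (∀ j, ‖t j‖ ≤ 1) → ‖∑ j, t j • g j i‖ ≤ 1)
    (hg : ∀ i ∉ A, ∃ h : E i, ‖h‖ ≤ 1 ∧ ∀ j, g j i = h) :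
    ‖∑ j, Φ (g j)‖ ≤ C := by
  induction hA using Finset.Nonempty.cons_induction generalizing g with
  | singleton m =>
    have hex : ∀ i, ∃ h : E i, ‖h‖ ≤ 1 ∧ (i ≠ m → ∀ j, g j i = h) := by
      intro i
      by_cases hi : i = m
      · exact ⟨0, by simp, fun h => absurd hi h⟩
      · obtain ⟨h, h1, h2⟩ := hg i (by simpa using hi)
        exact ⟨h, h1, fun _ => h2⟩
    choose h h1 h2 using hex
    have e : ∀ j, g j = Function.update h m (g j m) := by
      intro j
      ext i
      by_cases hi : i = m
      · subst hi; simp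
      · rw [Function.update_of_ne hi, h2 i hi]
    have : ∑ j, Φ (g j) = Φ (Function.update h m (∑ j, g j m)) := by
      rw [Φ.map_update_sum]
      exact Finset.sum_congr rfl fun j _ => by rw [← e j]
    rw [this]
    apply hΦ
    intro i
    by_cases hi : i = m
    · subst hi
      simpa using hgA i (by simp) (fun _ => 1) (by simp)
    · rw [Function.update_of_ne hi]
      exact h1 i
  | cons m A hm hA ih =>
    obtain ⟨p, hp⟩ := hA
    have hpm : p ≠ m := fun h => hm (h ▸ hp)
    set s : (J → ℤˣ) → J → 𝕜 := fun r j => ((r j : ℤ) : 𝕜) with hs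
    have hs1 : ∀ r j, ‖s r j‖ ≤ 1 := by
      intro r j
      rcases Int.units_eq_one_or (r j) with h | h <;> simp [hs, h]
    -- Coordinate m now holds one signed sum, independent of j, so it leaves A. The compensating
    -- sign is put in p ∈ A, where unimodular factors are harmless.
    set g' : (J → ℤˣ) → J → ∀ i, E i := fun r j =>
      Function.update (Function.update (g j) p (s r j • g j p)) m (∑ k, s r k • g k m) with hg'
    have hbound : ∀ r, ‖∑ j, Φ (g' r j)‖ ≤ C := by
      intro r
      apply ih
      · intro i hi t ht
        have him : i ≠ m := fun h => hm (h ▸ hi)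
        by_cases hip : i = p
        · subst hip
          simp only [hg', Function.update_of_ne hpm, Function.update_self, smul_smul]
          refine hgA i (Finset.mem_cons_of_mem hi) _ fun j => ?_
          rw [norm_mul]
          exact mul_le_one₀ (ht j) (norm_nonneg _) (hs1 r j)
        · simp only [hg', Function.update_of_ne him, Function.update_of_ne hip]
          exact hgA i (Finset.mem_cons_of_mem hi) t ht
      · intro i hi
        by_cases him : i = m
        · subst him
          refine ⟨∑ k, s r k • g k i, hgA i (Finset.mem_cons_self _ _) _ (hs1 r), fun j => ?_⟩
          simp [hg']
        · have hip : i ≠ p := fun h => hi (h ▸ hp)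
          obtain ⟨h, h1, h2⟩ := hg i (by simp [him, hi])
          refine ⟨h, h1, fun j => ?_⟩
          simp only [hg', Function.update_of_ne him, Function.update_of_ne hip, h2]
    have hexp : ∀ r j, Φ (g' r j) =
        ∑ k, (s r j * s r k) * Φ (Function.update (g j) m (g k m)) := by
      intro r j
      simp only [hg']
      rw [Φ.map_update_sum]
      refine Finset.sum_congr rfl fun k _ => ?_
      rw [Φ.map_update_smul, Function.update_comm hpm.symm.symm, Φ.map_update_smul,
        ← Function.update_comm hpm, Function.update_eq_self p (g j)]
      simp only [smul_eq_mul]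
      ring
    -- Orthogonality of the signs leaves only the terms k = j.
    have havg : ∑ r, ∑ j, Φ (g' r j) = (Fintype.card (J → ℤˣ) : 𝕜) * ∑ j, Φ (g j) := by
      simp_rw [hexp]
      rw [Finset.sum_comm, Finset.mul_sum]
      refine Finset.sum_congr rfl fun j _ => ?_
      rw [Finset.sum_comm]
      simp_rw [← Finset.sum_mul, hs, sum_sign_mul_sign]
      simp
    have hN : (0 : ℝ) < Fintype.card (J → ℤˣ) := by
      exact_mod_cast Fintype.card_pos
    have hle : (Fintype.card (J → ℤˣ) : ℝ) * ‖∑ j, Φ (g j)‖ ≤ Fintype.card (J → ℤˣ) * C := by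
      calc (Fintype.card (J → ℤˣ) : ℝ) * ‖∑ j, Φ (g j)‖ = ‖∑ r, ∑ j, Φ (g' r j)‖ := by
            rw [havg, norm_mul]; simp
        _ ≤ ∑ _r : J → ℤˣ, C := norm_sum_le_of_le _ fun r _ => hbound r
        _ = _ := by simp
    exact le_of_mul_le_mul_left hle hN

end SignAveraging

/-! ### Operators on projective tensor products and the block estimate. -/

section ProjTensorMap

variable {𝕜 : Type*} [RCLike 𝕜] {n : ℕ} {E F G : Fin n → Type*} [∀ i, NormedAddCommGroup (E i)]
  [∀ i, NormedSpace 𝕜 (E i)] [∀ i, NormedAddCommGroup (F i)] [∀ i, NormedSpace 𝕜 (F i)]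
  [∀ i, NormedAddCommGroup (G i)] [∀ i, NormedSpace 𝕜 (G i)]

/-- Elementary tensors in the projective tensor product. -/
def elemTensor (𝕜 : Type*) [RCLike 𝕜] {n : ℕ} {E : Fin n → Type*} [∀ i, NormedAddCommGroup (E i)]
    [∀ i, NormedSpace 𝕜 (E i)] (f : ∀ i, E i) : ProjTensor 𝕜 E :=
  ((PiTensorProduct.tprod 𝕜 f : ⨂[𝕜] i, E i) : Completion (⨂[𝕜] i, E i))

theorem projTensorMap_elemTensor (g : ∀ i, E i →L[𝕜] F i) (f : ∀ i, E i) :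
    projTensorMap 𝕜 g (elemTensor 𝕜 f) = elemTensor 𝕜 fun i => g i (f i) := by
  rw [projTensorMap, elemTensor]
  erw [ContinuousLinearMap.completion_apply_coe]
  simp [elemTensor]

/-- A closed submodule containing the elementary tensors is everything. -/
theorem eq_top_of_elemTensor_mem (W : Submodule 𝕜 (ProjTensor 𝕜 E))
    (hW : IsClosed (W : Set (ProjTensor 𝕜 E))) (h : ∀ f, elemTensor 𝕜 f ∈ W) : W = ⊤ := by
  rw [eq_top_iff]
  rintro x -
  induction x using Completion.induction_on with
  | hp => exact hW
  | ih a =>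
    have ha : a ∈ Submodule.span 𝕜 (Set.range (PiTensorProduct.tprod 𝕜 (s := E))) := by
      rw [PiTensorProduct.span_tprod_eq_top]; trivial
    induction ha using Submodule.span_induction with
    | mem x hx =>
      obtain ⟨f, rfl⟩ := hx
      exact h f
    | zero => exact W.zero_mem
    | add x y _ _ hx hy => rw [Completion.coe_add]; exact W.add_mem hx hy
    | smul c x _ hx => rw [Completion.coe_smul]; exact W.smul_mem c hx

theorem ext_elemTensor {Y : Type*} [NormedAddCommGroup Y] [NormedSpace 𝕜 Y]
    {S T : ProjTensor 𝕜 E →L[𝕜] Y} (h : ∀ f, S (elemTensor 𝕜 f) = T (elemTensor 𝕜 f)) : S = T := by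
  have : (S - T).ker = ⊤ := eq_top_of_elemTensor_mem _ (S - T).isClosed_ker fun f => by
    simp [h f]
  ext1 x
  have hx : x ∈ (S - T).ker := by rw [this]; trivial
  exact sub_eq_zero.mp hx

theorem projTensorMap_mul (f g : ∀ i, E i →L[𝕜] E i) :
    projTensorMap 𝕜 (f * g) = projTensorMap 𝕜 f * projTensorMap 𝕜 g :=
  ext_elemTensor fun v => by
    rw [mul_apply_eq_comp, projTensorMap_elemTensor, projTensorMap_elemTensor,
      projTensorMap_elemTensor]
    rfl

theorem projTensorMap_one : projTensorMap 𝕜 (1 : ∀ i, E i →L[𝕜] E i) = 1 :=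
  ext_elemTensor fun v => by
    rw [projTensorMap_elemTensor]
    rfl

theorem norm_projTensorMap_apply_le (f : ∀ i, E i →L[𝕜] F i) (x : ProjTensor 𝕜 E) :
    ‖projTensorMap 𝕜 f x‖ ≤ (∏ i, ‖f i‖) * ‖x‖ := by
  induction x using Completion.induction_on with
  | hp => exact isClosed_le (by fun_prop) (by fun_prop)
  | ih a =>
    rw [projTensorMap]
    erw [ContinuousLinearMap.completion_apply_coe]
    rw [Completion.norm_coe, Completion.norm_coe]
    exact (PiTensorProduct.mapL f).le_of_opNorm_le (PiTensorProduct.opNorm_mapL f) a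

theorem norm_projTensorMap_apply_le_of_le_one {f : ∀ i, E i →L[𝕜] F i} (hf : ∀ i, ‖f i‖ ≤ 1)
    (x : ProjTensor 𝕜 E) : ‖projTensorMap 𝕜 f x‖ ≤ ‖x‖ := by
  refine (norm_projTensorMap_apply_le f x).trans ?_
  exact mul_le_of_le_one_left (norm_nonneg x)
    (Finset.prod_le_one (fun i _ => norm_nonneg _) fun i _ => hf i)

theorem elemTensor_add_smul_update (f : ∀ i, E i) (m : Fin n) (c : 𝕜) (x y : E m) :
    elemTensor 𝕜 (Function.update f m (x + c • y)) =
      elemTensor 𝕜 (Function.update f m x) + c • elemTensor 𝕜 (Function.update f m y) := by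
  simp [elemTensor, Completion.coe_add, Completion.coe_smul]

/-- The operator acting as `T` on the `m`-th factor and trivially on the others. -/
def coordMap (m : Fin n) (T : E m →L[𝕜] E m) : ProjTensor 𝕜 E →L[𝕜] ProjTensor 𝕜 E :=
  projTensorMap 𝕜 (Pi.mulSingle m T)

theorem coordMap_elemTensor (m : Fin n) (T : E m →L[𝕜] E m) (f : ∀ i, E i) :
    coordMap m T (elemTensor 𝕜 f) = elemTensor 𝕜 (Function.update f m (T (f m))) := by
  rw [coordMap, projTensorMap_elemTensor]
  congr 1
  ext i
  by_cases hi : i = m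
  · subst hi; simp
  · simp [Pi.mulSingle_eq_of_ne hi, Function.update_of_ne hi]

theorem coordMap_mul (m : Fin n) (S T : E m →L[𝕜] E m) :
    coordMap m (S * T) = coordMap m S * coordMap (𝕜 := 𝕜) m T := by
  rw [coordMap, Pi.mulSingle_mul, projTensorMap_mul]; rfl

theorem coordMap_one (m : Fin n) : coordMap m (1 : E m →L[𝕜] E m) = 1 := by
  rw [coordMap, Pi.mulSingle_one, projTensorMap_one]

theorem coordMap_add (m : Fin n) (S T : E m →L[𝕜] E m) :
    coordMap m (S + T) = coordMap m S + coordMap m T :=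
  ext_elemTensor fun f => by
    have := elemTensor_add_smul_update f m (1 : 𝕜) (S (f m)) (T (f m))
    simpa [coordMap_elemTensor] using this

theorem coordMap_sub (m : Fin n) (S T : E m →L[𝕜] E m) :
    coordMap m (S - T) = coordMap m S - coordMap m T := by
  rw [eq_sub_iff_add_eq, ← coordMap_add, sub_add_cancel]

theorem coordMap_zero (m : Fin n) : coordMap m (0 : E m →L[𝕜] E m) = 0 := by
  rw [← sub_self (0 : E m →L[𝕜] E m), coordMap_sub, sub_self]

theorem coordMap_commute {m k : Fin n} (h : m ≠ k) (S : E m →L[𝕜] E m) (T : E k →L[𝕜] E k) :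
    Commute (coordMap m S) (coordMap k T) := by
  refine ext_elemTensor fun f => ?_
  rw [mul_apply_eq_comp, mul_apply_eq_comp, coordMap_elemTensor, coordMap_elemTensor,
    coordMap_elemTensor, coordMap_elemTensor, Function.update_of_ne h, Function.update_of_ne h.symm,
    Function.update_comm h]

theorem norm_coordMap_apply_le (m : Fin n) (T : E m →L[𝕜] E m) (x : ProjTensor 𝕜 E) :
    ‖coordMap m T x‖ ≤ ‖T‖ * ‖x‖ := by
  refine (norm_projTensorMap_apply_le _ x).trans ?_
  gcongr
  rw [← Finset.mul_prod_erase _ _ (Finset.mem_univ m), Pi.mulSingle_eq_same]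
  refine mul_le_of_le_one_right (norm_nonneg _) (Finset.prod_le_one (fun i _ => norm_nonneg _) ?_)
  intro i hi
  rw [Pi.mulSingle_eq_of_ne (Finset.ne_of_mem_erase hi)]
  exact ContinuousLinearMap.norm_id_le

theorem norm_coordMap_apply_le_of_le_one (m : Fin n) {T : E m →L[𝕜] E m} (hT : ‖T‖ ≤ 1)
    (x : ProjTensor 𝕜 E) : ‖coordMap m T x‖ ≤ ‖x‖ :=
  (norm_coordMap_apply_le m T x).trans (mul_le_of_le_one_left (norm_nonneg _) hT)

/-- Telescoping: the factors are switched on one coordinate at a time, and each contraction does not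
enlarge the error made so far. -/
theorem norm_sub_projTensorMap_le {B : ∀ i, E i →L[𝕜] E i} (hB : ∀ i, ‖B i‖ ≤ 1)
    (x : ProjTensor 𝕜 E) :
    ‖x - projTensorMap 𝕜 B x‖ ≤ ∑ i, ‖x - coordMap i (B i) x‖ := by
  have key : ∀ s : Finset (Fin n),
      ‖x - projTensorMap 𝕜 (fun i => if i ∈ s then B i else 1) x‖ ≤
        ∑ i ∈ s, ‖x - coordMap i (B i) x‖ := by
    intro s
    induction s using Finset.induction_on with
    | empty =>
      have : projTensorMap 𝕜 (fun i => if i ∈ (∅ : Finset (Fin n)) then B i else 1) = 1 := by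
        simp only [Finset.notMem_empty, if_false]
        exact projTensorMap_one
      rw [this]
      simp
    | insert a s ha ih =>
      have h1 : (fun i => if i ∈ insert a s then B i else 1) =
          Pi.mulSingle a (B a) * (fun i => if i ∈ s then B i else 1) := by
        ext1 i
        by_cases hi : i = a
        · subst hi; simp [ha]
        · simp [hi]
      rw [h1, projTensorMap_mul, Finset.sum_insert ha, mul_apply_eq_comp]
      change ‖x - coordMap a (B a) _‖ ≤ _
      set y := projTensorMap 𝕜 (fun i => if i ∈ s then B i else 1) x
      have h2 : x - coordMap a (B a) y = (x - coordMap a (B a) x) + coordMap a (B a) (x - y) := by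
        rw [map_sub]; abel
      rw [h2]
      refine (norm_add_le _ _).trans (add_le_add le_rfl (le_trans ?_ ih))
      exact norm_coordMap_apply_le_of_le_one a (hB a) _
  simpa using key Finset.univ

/-- Bounded pointwise convergence to zero passes from a factor to the projective tensor product. -/
theorem tendsto_coordMap_zero {α : Type*} {l : Filter α} (m : Fin n) (P : α → E m →L[𝕜] E m)
    {C : ℝ} (hC : ∀ a, ‖P a‖ ≤ C) (hP : ∀ f, Tendsto (fun a => P a f) l (𝓝 0))
    (x : ProjTensor 𝕜 E) : Tendsto (fun a => coordMap m (P a) x) l (𝓝 0) := by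
  let W : Submodule 𝕜 (ProjTensor 𝕜 E) :=
    { carrier := {x | Tendsto (fun a => coordMap m (P a) x) l (𝓝 0)}
      zero_mem' := by simpa using tendsto_const_nhds
      add_mem' := fun {x y} hx hy => by simpa using Tendsto.add hx hy
      smul_mem' := fun c x hx => by simpa using Tendsto.const_smul hx c }
  have hW : W = ⊤ := by
    refine eq_top_of_elemTensor_mem W ?_ ?_
    · rw [← isSeqClosed_iff_isClosed]
      intro u x hu hux
      change Tendsto _ _ _
      rw [NormedAddGroup.tendsto_nhds_zero]
      intro ε hε
      obtain ⟨k, hk⟩ := Metric.tendsto_atTop.mp hux (ε / (2 * (|C| + 1))) (by positivity)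
      have hk' := hk k le_rfl
      rw [dist_eq_norm, lt_div_iff₀ (by positivity)] at hk'
      filter_upwards [NormedAddGroup.tendsto_nhds_zero.mp (hu k) (ε / 2) (half_pos hε)] with a ha
      have h1 := norm_coordMap_apply_le m (P a) (u k - x)
      rw [map_sub] at h1
      have h2 := norm_le_norm_add_norm_sub (coordMap m (P a) (u k)) (coordMap m (P a) x)
      have h3 : ‖P a‖ * ‖u k - x‖ ≤ |C| * ‖u k - x‖ := by
        gcongr
        exact (hC a).trans (le_abs_self C)
      nlinarith [norm_nonneg (u k - x)]
    · intro f
      have h1 : ∀ a, ‖coordMap m (P a) (elemTensor 𝕜 f)‖ ≤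
          ‖P a (f m)‖ * ∏ i ∈ Finset.univ.erase m, ‖f i‖ := by
        intro a
        rw [coordMap_elemTensor, elemTensor, Completion.norm_coe]
        refine (PiTensorProduct.projectiveSeminorm_tprod_le _).trans ?_
        rw [← Finset.mul_prod_erase _ _ (Finset.mem_univ m), Function.update_self,
          Finset.prod_congr rfl fun i hi => by
            rw [Function.update_of_ne (Finset.ne_of_mem_erase hi)]]
      refine squeeze_zero_norm h1 ?_
      simpa using ((hP (f m)).norm).mul_const (∏ i ∈ Finset.univ.erase m, ‖f i‖)
  have hx : x ∈ W := by rw [hW]; trivial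
  exact hx

/-- From 1 - V(1 - S) = (1 - V)(1 - P) + (1 - V)P + VS. In the application V and S are
multiplications by clopen sets and P is evaluation at a point. -/
theorem norm_sub_coordMap_le (m : Fin n) {V S P : E m →L[𝕜] E m} (hV : ‖V‖ ≤ 1)
    (hV' : ‖1 - V‖ ≤ 1) (x : ProjTensor 𝕜 E) :
    ‖x - coordMap m (V - V * S) x‖ ≤ ‖coordMap m ((1 - V) * (1 - P)) x‖ + ‖coordMap m P x‖ +
      ‖coordMap m S x‖ := by
  have h1 : x - coordMap m (V - V * S) x = coordMap m ((1 - V) * (1 - P)) x +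
      coordMap m (1 - V) (coordMap m P x) + coordMap m V (coordMap m S x) := by
    simp only [coordMap_mul, coordMap_sub, coordMap_one, mul_apply_eq_comp, sub_apply,
      one_apply_eq_self, map_sub]
    abel
  rw [h1]
  refine norm_add₃_le.trans ?_
  gcongr
  · exact norm_coordMap_apply_le_of_le_one m hV' _
  · exact norm_coordMap_apply_le_of_le_one m hV _

/-- The norm of a functional is attained up to `ε` on elementary tensors of the unit ball. -/
theorem exists_elemTensor_norm_le (φ : ProjTensor 𝕜 E →L[𝕜] 𝕜) {ε : ℝ} (hε : 0 < ε) :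
    ∃ f : ∀ i, E i, (∀ i, ‖f i‖ ≤ 1) ∧ ‖φ‖ ≤ ‖φ (elemTensor 𝕜 f)‖ + ε := by
  by_contra! hcon
  have h0 : 0 ≤ ‖φ‖ - ε := by
    have := hcon 0 (by simp)
    linarith [norm_nonneg (φ (elemTensor 𝕜 0))]
  have hb : ∀ f, ‖φ (elemTensor 𝕜 f)‖ ≤ (‖φ‖ - ε) * ∏ i, ‖f i‖ := by
    intro f
    have hf : f = fun i => ((‖f i‖ : ℝ) : 𝕜) • (((‖f i‖ : ℝ) : 𝕜)⁻¹ • f i) := by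
      ext i
      by_cases hi : f i = 0
      · simp [hi]
      · rw [smul_smul, mul_inv_cancel₀ (by simpa using hi), one_smul]
    have h1 := hcon (fun i => ((‖f i‖ : ℝ) : 𝕜)⁻¹ • f i) (fun i => by
      rw [norm_smul, norm_inv, RCLike.norm_ofReal, abs_norm]
      exact inv_mul_le_one)
    have h2 : elemTensor 𝕜 f = (∏ i, ((‖f i‖ : ℝ) : 𝕜)) •
        elemTensor 𝕜 (fun i => ((‖f i‖ : ℝ) : 𝕜)⁻¹ • f i) := by
      conv_lhs => rw [hf]
      rw [elemTensor, MultilinearMap.map_smul_univ, Completion.coe_smul]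
      rfl
    rw [h2, map_smul, norm_smul, norm_prod, mul_comm]
    simp only [RCLike.norm_ofReal, abs_norm]
    gcongr
    linarith
  let ψ : (⨂[𝕜] i, E i) →L[𝕜] 𝕜 := φ ∘L Completion.toComplL
  have hψ : ‖ψ‖ ≤ ‖φ‖ - ε := by
    rw [← (PiTensorProduct.liftIsometry 𝕜 E 𝕜).symm.norm_map ψ]
    refine ContinuousMultilinearMap.opNorm_le_bound h0 fun f => ?_
    rw [PiTensorProduct.liftIsometry_symm_apply]
    exact hb f
  have hφ : ‖φ‖ ≤ ‖φ‖ - ε := by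
    refine ContinuousLinearMap.opNorm_le_bound _ h0 fun x => ?_
    induction x using Completion.induction_on with
    | hp => exact isClosed_le (by fun_prop) (by fun_prop)
    | ih a =>
      rw [Completion.norm_coe]
      exact ψ.le_of_opNorm_le hψ a
  linarith

/-- Upper `c₀`-estimate for block operators: in the coordinates of `A ≠ ∅` the operators `T j i` have
disjoint ranges in the sense of `hA`, in the others they are a fixed rank-one contraction. -/
theorem norm_sum_block_le {J : Type*} [Fintype J] (T : J → ∀ i, E i →L[𝕜] E i)
    (A : Finset (Fin n)) (hAne : A.Nonempty)
    (hA : ∀ i ∈ A, ∀ f : J → E i, (∀ j, ‖f j‖ ≤ 1) → ‖∑ j, T j i (f j)‖ ≤ 1)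
    (hT : ∀ i ∉ A, ∃ h : E i, ‖h‖ ≤ 1 ∧ ∀ f : E i, ‖f‖ ≤ 1 →
      ∃ c : 𝕜, ‖c‖ ≤ 1 ∧ ∀ j, T j i f = c • h)
    (x : J → ProjTensor 𝕜 E) {M : ℝ} (hM : 0 ≤ M) (hx : ∀ j, ‖x j‖ ≤ M) :
    ‖∑ j, projTensorMap 𝕜 (T j) (x j)‖ ≤ M := by
  classical
  -- With φ norming the sum and ψ j = φ ∘ (block j), it suffices to show ∑ ‖ψ j‖ ≤ 1. Each ‖ψ j‖ is
  -- almost attained on an elementary tensor.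
  obtain ⟨φ, hφ, hφx⟩ := exists_dual_vector'' 𝕜 (∑ j, projTensorMap 𝕜 (T j) (x j))
  set ψ : J → ProjTensor 𝕜 E →L[𝕜] 𝕜 := fun j => φ ∘L projTensorMap 𝕜 (T j) with hψ
  have hφ1 : ∀ v : ∀ i, E i, (∀ i, ‖v i‖ ≤ 1) → ‖φ (elemTensor 𝕜 v)‖ ≤ 1 := by
    intro v hv
    refine (φ.le_of_opNorm_le hφ _).trans ?_
    rw [one_mul, elemTensor, Completion.norm_coe]
    exact (PiTensorProduct.projectiveSeminorm_tprod_le v).trans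
      (Finset.prod_le_one (fun i _ => norm_nonneg _) fun i _ => hv i)
  let Φ : MultilinearMap 𝕜 E 𝕜 :=
    ((φ ∘L Completion.toComplL : (⨂[𝕜] i, E i) →L[𝕜] 𝕜) :
      (⨂[𝕜] i, E i) →ₗ[𝕜] 𝕜).compMultilinearMap (PiTensorProduct.tprod 𝕜)
  have hΦ : ∀ v, Φ v = φ (elemTensor 𝕜 v) := fun v => rfl
  have helem : ∀ f : J → ∀ i, E i, (∀ j i, ‖f j i‖ ≤ 1) →
      ∑ j, ‖ψ j (elemTensor 𝕜 (f j))‖ ≤ 1 := by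
    intro f hf
    obtain ⟨p, hp⟩ := hAne
    have hex : ∀ i, ∃ h : E i, ‖h‖ ≤ 1 ∧ ∃ c : J → 𝕜, (∀ j, ‖c j‖ ≤ 1) ∧
        ∀ j, T j i (f j i) = c j • (if i ∈ A then T j i (f j i) else h) := by
      intro i
      by_cases hi : i ∈ A
      · exact ⟨0, by simp, fun _ => 1, by simp, by simp [hi]⟩
      · obtain ⟨h, h1, h2⟩ := hT i hi
        choose c hc1 hc using fun j => h2 (f j i) (hf j i)
        exact ⟨h, h1, c, hc1, fun j => by rw [if_neg hi]; exact hc j j⟩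
    choose h hh c hc hcT using hex
    set g : J → ∀ i, E i := fun j i => if i ∈ A then T j i (f j i) else h i with hg
    have hψg : ∀ j, ‖ψ j (elemTensor 𝕜 (f j))‖ ≤ ‖Φ (g j)‖ := by
      intro j
      have : ψ j (elemTensor 𝕜 (f j)) = Φ (fun i => c i j • g j i) := by
        rw [hΦ, hψ, ContinuousLinearMap.comp_apply, projTensorMap_elemTensor]
        congr 2
        ext i
        exact hcT i j
      rw [this, Φ.map_smul_univ, norm_smul, norm_prod]
      exact mul_le_of_le_one_left (norm_nonneg _)
        (Finset.prod_le_one (fun i _ => norm_nonneg _) fun i _ => hc i j)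
    -- Rotations placed in coordinate p turn the diagonal sum into the sum of the absolute values.
    have hrot : ∀ j, ∃ r : 𝕜, ‖r‖ ≤ 1 ∧ r * Φ (g j) = (‖Φ (g j)‖ : 𝕜) := by
      intro j
      obtain ⟨r, hr, hr'⟩ := RCLike.exists_norm_eq_mul_self (Φ (g j))
      exact ⟨r, hr.le, hr'.symm⟩
    choose r hr hr' using hrot
    have hdiag := norm_sum_diagonal_le Φ (C := 1) hφ1 A ⟨p, hp⟩
      (fun j => Function.update (g j) p (r j • g j p)) (by
        intro i hi t ht
        have hTt : ∀ t : J → 𝕜, (∀ j, ‖t j‖ ≤ 1) → ‖∑ j, t j • g j i‖ ≤ 1 := by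
          intro t ht
          have := hA i hi (fun j => t j • f j i) fun j => by
            rw [norm_smul]
            exact mul_le_one₀ (ht j) (norm_nonneg _) (hf j i)
          simpa [hg, hi] using this
        by_cases hip : i = p
        · subst hip
          simp only [Function.update_self, smul_smul]
          refine hTt _ fun j => ?_
          rw [norm_mul]
          exact mul_le_one₀ (ht j) (norm_nonneg _) (hr j)
        · simp only [Function.update_of_ne hip]
          exact hTt t ht) (by
        intro i hi
        have hip : i ≠ p := fun h => hi (h ▸ hp)
        refine ⟨h i, hh i, fun j => ?_⟩
        rw [Function.update_of_ne hip]
        simp [hg, hi])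
    have hval : ∑ j, Φ (Function.update (g j) p (r j • g j p)) =
        ((∑ j, ‖Φ (g j)‖ : ℝ) : 𝕜) := by
      push_cast
      refine Finset.sum_congr rfl fun j _ => ?_
      rw [Φ.map_update_smul, Function.update_eq_self, smul_eq_mul, hr']
    rw [hval, RCLike.norm_ofReal, abs_of_nonneg (by positivity)] at hdiag
    exact (Finset.sum_le_sum fun j _ => hψg j).trans hdiag
  have hsum : ∑ j, ‖ψ j‖ ≤ 1 := by
    refine le_of_forall_pos_le_add fun ε hε => ?_
    have hε' : 0 < ε / (Fintype.card J + 1) := by positivity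
    choose f hf hfψ using fun j => exists_elemTensor_norm_le (ψ j) hε'
    calc ∑ j, ‖ψ j‖ ≤ ∑ j, (‖ψ j (elemTensor 𝕜 (f j))‖ + ε / (Fintype.card J + 1)) :=
          Finset.sum_le_sum fun j _ => hfψ j
      _ = ∑ j, ‖ψ j (elemTensor 𝕜 (f j))‖ + Fintype.card J * (ε / (Fintype.card J + 1)) := by
          rw [Finset.sum_add_distrib]; simp
      _ ≤ 1 + ε := by
          refine add_le_add (helem f hf) ?_
          rw [mul_div_assoc', div_le_iff₀ (by positivity)]
          nlinarith
  have h1 : ‖φ (∑ j, projTensorMap 𝕜 (T j) (x j))‖ = ‖∑ j, projTensorMap 𝕜 (T j) (x j)‖ := by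
    rw [hφx, RCLike.norm_ofReal, abs_norm]
  rw [← h1, map_sum]
  calc ‖∑ j, φ (projTensorMap 𝕜 (T j) (x j))‖ ≤ ∑ j, ‖ψ j‖ * M :=
        norm_sum_le_of_le _ fun j _ => ((ψ j).le_opNorm (x j)).trans (by gcongr; exact hx j)
    _ = (∑ j, ‖ψ j‖) * M := by rw [Finset.sum_mul]
    _ ≤ M := mul_le_of_le_one_left hM hsum

theorem norm_sum_finset_block_le {J : Type*} (F : Finset J) (T : J → ∀ i, E i →L[𝕜] E i)
    (A : Finset (Fin n)) (hAne : A.Nonempty)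
    (hA : ∀ i ∈ A, ∀ f : F → E i, (∀ j, ‖f j‖ ≤ 1) → ‖∑ j : F, T j i (f j)‖ ≤ 1)
    (hT : ∀ i ∉ A, ∃ h : E i, ‖h‖ ≤ 1 ∧ ∀ f : E i, ‖f‖ ≤ 1 →
      ∃ c : 𝕜, ‖c‖ ≤ 1 ∧ ∀ j : F, T j i f = c • h)
    (x : J → ProjTensor 𝕜 E) {M : ℝ} (hM : 0 ≤ M) (hx : ∀ j ∈ F, ‖x j‖ ≤ M) :
    ‖∑ j ∈ F, projTensorMap 𝕜 (T j) (x j)‖ ≤ M := by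
  rw [← Finset.sum_coe_sort F fun j => projTensorMap 𝕜 (T j) (x j)]
  exact norm_sum_block_le (fun j : F => T j) A hAne hA hT (fun j : F => x j) hM fun j => hx j j.2

/-- A tensor product of operators of rank one has rank one. -/
theorem projTensorMap_mem_span (P : ∀ i, E i →L[𝕜] E i) (e : ∀ i, E i)
    (hP : ∀ i f, ∃ c : 𝕜, P i f = c • e i) (x : ProjTensor 𝕜 E) :
    projTensorMap 𝕜 P x ∈ Submodule.span 𝕜 {elemTensor 𝕜 e} := by
  set L := Submodule.span 𝕜 {elemTensor 𝕜 e}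
  have hL : IsClosed (L : Set (ProjTensor 𝕜 E)) := Submodule.closed_of_finiteDimensional L
  have htop := eq_top_of_elemTensor_mem
    (L.comap (projTensorMap 𝕜 P : ProjTensor 𝕜 E →ₗ[𝕜] ProjTensor 𝕜 E))
    (hL.preimage (projTensorMap 𝕜 P).continuous) fun f => by
      rw [Submodule.mem_comap]
      change projTensorMap 𝕜 P (elemTensor 𝕜 f) ∈ L
      choose c hc using fun i => hP i (f i)
      rw [projTensorMap_elemTensor, Submodule.mem_span_singleton]
      refine ⟨∏ i, c i, ?_⟩
      rw [elemTensor, elemTensor, ← Completion.coe_smul, ← MultilinearMap.map_smul_univ]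
      simp only [hc]
  have hx : x ∈ L.comap (projTensorMap 𝕜 P : ProjTensor 𝕜 E →ₗ[𝕜] ProjTensor 𝕜 E) := by
    rw [htop]; trivial
  exact hx

/-- An element fixed in every coordinate is fixed by the full tensor product of the P i, whose range
lies in a line. -/
theorem finiteDimensional_of_coordMap_eq (P : ∀ i, E i →L[𝕜] E i) (e : ∀ i, E i)
    (hP1 : ∀ i, ‖P i‖ ≤ 1) (hP : ∀ i f, ∃ c : 𝕜, P i f = c • e i)
    {Z : Submodule 𝕜 (ProjTensor 𝕜 E)} (hZ : ∀ m, ∀ z ∈ Z, coordMap m (P m) z = z) :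
    FiniteDimensional 𝕜 Z := by
  refine Submodule.finiteDimensional_of_le (S₂ := Submodule.span 𝕜 {elemTensor 𝕜 e}) fun z hz => ?_
  have h1 := norm_sub_projTensorMap_le hP1 z
  have h2 : ∑ i, ‖z - coordMap i (P i) z‖ = 0 :=
    Finset.sum_eq_zero fun i _ => by rw [hZ i z hz, sub_self, norm_zero]
  rw [h2] at h1
  have h3 : z = projTensorMap 𝕜 P z := sub_eq_zero.mp (norm_le_zero_iff.mp h1)
  rw [h3]
  exact projTensorMap_mem_span P e hP z

end ProjTensorMap

/-- An isolated point of a preconnected set is relatively clopen in it, so it is the whole set. -/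
theorem IsScattered.totallyDisconnectedSpace {X : Type*} [TopologicalSpace X] [T1Space X]
    (hX : IsScattered X) : TotallyDisconnectedSpace X := by
  refine ⟨fun A _ hA x hx y hy => ?_⟩
  obtain ⟨z, hz, U, hU, hUA⟩ := hX A ⟨x, hx⟩
  have hall : ∀ w ∈ A, w = z := by
    by_contra! hcon
    obtain ⟨w, hw, hwz⟩ := hcon
    have hzU : z ∈ U ∩ A := by rw [hUA]; rfl
    obtain ⟨v, hvA, hvU, hvz⟩ := hA U {z}ᶜ hU isOpen_compl_singleton
      (fun a _ => by by_cases h : a = z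
                     · exact Or.inl (h ▸ hzU.1)
                     · exact Or.inr h) ⟨z, hz, hzU.1⟩ ⟨w, hw, hwz⟩
    have : v ∈ U ∩ A := ⟨hvU, hvA⟩
    rw [hUA] at this
    exact hvz this
  rw [hall x hx, hall y hy]

/-! ### Evaluations and clopen multiplications on C(X). -/

section Operators

variable {𝕜 : Type*} [RCLike 𝕜] {X : Type*} [TopologicalSpace X]

variable (𝕜) in
/-- The rank-one projection `f ↦ f(p) · 1`. -/
def evalOp (p : X) : C(X, 𝕜) →L[𝕜] C(X, 𝕜) :=
  (ContinuousMap.evalCLM 𝕜 p).smulRight 1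

@[simp] theorem evalOp_apply (p : X) (f : C(X, 𝕜)) : evalOp 𝕜 p f = f p • 1 := rfl

theorem evalOp_mul_self (p : X) : evalOp 𝕜 p * evalOp 𝕜 p = evalOp 𝕜 p := by
  ext f x
  simp

variable [CompactSpace X]

variable (𝕜) in
/-- The indicator function of a clopen set. -/
def clopenIndicator (S : Clopens X) : C(X, 𝕜) :=
  ⟨(S : Set X).indicator 1, IsClopen.continuous_indicator S.isClopen continuous_one⟩

variable (𝕜) in
/-- Multiplication by the indicator function of a clopen set. -/
def mulOp (S : Clopens X) : C(X, 𝕜) →L[𝕜] C(X, 𝕜) :=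
  ContinuousLinearMap.mul 𝕜 _ (clopenIndicator 𝕜 S)

open Classical in
theorem mulOp_apply (S : Clopens X) (f : C(X, 𝕜)) (x : X) :
    mulOp 𝕜 S f x = if x ∈ S then f x else 0 := by
  simp [mulOp, clopenIndicator, Set.indicator_apply]

theorem norm_one_continuousMap_le : ‖(1 : C(X, 𝕜))‖ ≤ 1 := by
  rw [ContinuousMap.norm_le _ zero_le_one]
  simp

theorem norm_mulOp_le (S : Clopens X) : ‖mulOp 𝕜 S‖ ≤ 1 := by
  classical
  refine ContinuousLinearMap.opNorm_le_bound _ zero_le_one fun f => ?_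
  rw [one_mul, ContinuousMap.norm_le _ (norm_nonneg _)]
  intro x
  rw [mulOp_apply]
  split_ifs
  · exact f.norm_coe_le_norm x
  · simp

theorem norm_evalOp_le (p : X) : ‖evalOp 𝕜 p‖ ≤ 1 := by
  refine ContinuousLinearMap.opNorm_le_bound _ zero_le_one fun f => ?_
  rw [evalOp_apply, norm_smul, one_mul]
  exact (mul_le_of_le_one_right (norm_nonneg _) norm_one_continuousMap_le).trans
    (f.norm_coe_le_norm p)

theorem mulOp_mul (S T : Clopens X) : mulOp 𝕜 S * mulOp 𝕜 T = mulOp 𝕜 (S ⊓ T) := by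
  classical
  ext f x
  simp only [mul_apply_eq_comp, mulOp_apply, ← SetLike.mem_coe, Clopens.coe_inf, Set.mem_inter_iff]
  split_ifs <;> tauto

theorem mulOp_top : mulOp 𝕜 (⊤ : Clopens X) = 1 := by
  classical
  ext f x
  simp [mulOp_apply, ← SetLike.mem_coe]

theorem mulOp_bot : mulOp 𝕜 (⊥ : Clopens X) = 0 := by
  classical
  ext f x
  simp [mulOp_apply, ← SetLike.mem_coe]

theorem mulOp_sup (S T : Clopens X) :
    mulOp 𝕜 (S ⊔ T) = mulOp 𝕜 S + (1 - mulOp 𝕜 S) * mulOp 𝕜 T := by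
  classical
  ext f x
  simp only [mul_apply_eq_comp, mulOp_apply, ← SetLike.mem_coe, Clopens.coe_sup, Set.mem_union,
    add_apply, sub_apply, ContinuousMap.add_apply,
    ContinuousMap.sub_apply, one_apply_eq_self]
  by_cases h1 : x ∈ (S : Set X) <;> by_cases h2 : x ∈ (T : Set X) <;> simp [h1, h2]

theorem mulOp_sdiff (S T : Clopens X) :
    mulOp 𝕜 (S \ T) = mulOp 𝕜 S - mulOp 𝕜 S * mulOp 𝕜 T := by
  classical
  ext f x
  simp only [mul_apply_eq_comp, mulOp_apply, ← SetLike.mem_coe, Clopens.coe_sdiff, Set.mem_sdiff,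
    sub_apply, ContinuousMap.sub_apply]
  by_cases h1 : x ∈ (S : Set X) <;> by_cases h2 : x ∈ (T : Set X) <;> simp [h1, h2]

theorem norm_one_sub_mulOp_le (S : Clopens X) : ‖1 - mulOp 𝕜 S‖ ≤ 1 := by
  have : (1 - mulOp 𝕜 S) = mulOp 𝕜 Sᶜ := by
    rw [← top_sdiff, mulOp_sdiff, mulOp_top, one_mul]
  rw [this]
  exact norm_mulOp_le _

theorem norm_one_sub_evalOp_le (p : X) : ‖1 - evalOp 𝕜 p‖ ≤ 2 := by
  refine (norm_sub_le _ _).trans ?_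
  have h1 : ‖(1 : C(X, 𝕜) →L[𝕜] C(X, 𝕜))‖ ≤ 1 := ContinuousLinearMap.norm_id_le
  linarith [norm_evalOp_le (𝕜 := 𝕜) p]

theorem norm_one_sub_mulOp_mul_le (p : X) (S : {S : Clopens X // p ∉ S}) :
    ‖(1 - mulOp 𝕜 S.1) * (1 - evalOp 𝕜 p)‖ ≤ 2 :=
  calc ‖(1 - mulOp 𝕜 S.1) * (1 - evalOp 𝕜 p)‖ ≤ ‖1 - mulOp 𝕜 S.1‖ * ‖1 - evalOp 𝕜 p‖ :=
        norm_mul_le _ _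
    _ ≤ 1 * 2 := by
        gcongr
        · exact norm_one_sub_mulOp_le S.1
        · exact norm_one_sub_evalOp_le p
    _ = 2 := one_mul 2

/-- With directedness this makes `atTop` nontrivial, so a limit along it yields an actual clopen
set. -/
instance clopensAvoidingNonempty (p : X) : Nonempty {S : Clopens X // p ∉ S} := ⟨⟨⊥, id⟩⟩

instance clopensAvoidingDirected (p : X) : IsDirectedOrder {S : Clopens X // p ∉ S} :=
  ⟨fun S T => ⟨⟨S.1 ⊔ T.1, fun h => h.elim S.2 T.2⟩, le_sup_left (a := S.1), le_sup_right (a := S.1)⟩⟩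

/-- A function vanishing at `p` is small off a clopen set missing `p`. -/
theorem tendsto_one_sub_mulOp [T2Space X] [TotallyDisconnectedSpace X] (p : X) (f : C(X, 𝕜)) :
    Tendsto (fun S : {S : Clopens X // p ∉ S} => ((1 - mulOp 𝕜 S.1) * (1 - evalOp 𝕜 p)) f)
      atTop (𝓝 0) := by
  classical
  rw [NormedAddGroup.tendsto_nhds_zero]
  intro ε hε
  have hO : IsOpen {x | ‖f x - f p‖ < ε / 2} := isOpen_lt (by fun_prop) (by fun_prop)
  obtain ⟨V, hV, hpV, hVO⟩ := compact_exists_isClopen_in_isOpen hO (x := p) (by simpa using hε)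
  filter_upwards [eventually_ge_atTop ⟨⟨Vᶜ, hV.compl⟩, fun h => h hpV⟩] with S' hS'
  refine lt_of_le_of_lt ?_ (half_lt_self hε)
  rw [ContinuousMap.norm_le _ (half_pos hε).le]
  intro x
  simp only [mul_apply_eq_comp, sub_apply, ContinuousMap.sub_apply, mulOp_apply,
    one_apply_eq_self, evalOp_apply]
  split_ifs with hx
  · simpa using (half_pos hε).le
  · have hxV : x ∈ V := by
      by_contra h
      exact hx (hS' h)
    simpa using (hVO hxV).le

/-- Sums of contractively bounded functions with disjoint clopen supports are bounded. -/
theorem norm_sum_mulOp_le {J : Type*} [Fintype J] (D : J → Clopens X)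
    (hD : ∀ j k, j ≠ k → Disjoint (D j) (D k)) (f : J → C(X, 𝕜)) (hf : ∀ j, ‖f j‖ ≤ 1) :
    ‖∑ j, mulOp 𝕜 (D j) (f j)‖ ≤ 1 := by
  classical
  rw [ContinuousMap.norm_le _ zero_le_one]
  intro x
  rw [ContinuousMap.sum_apply]
  simp only [mulOp_apply]
  by_cases hx : ∃ j, x ∈ D j
  · obtain ⟨j, hj⟩ := hx
    rw [Finset.sum_eq_single j]
    · rw [if_pos hj]
      exact ((f j).norm_coe_le_norm x).trans (hf j)
    · intro k _ hk
      rw [if_neg]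
      intro hxk
      exact Set.disjoint_left.mp (Clopens.coe_disjoint.mpr (hD k j hk)) hxk hj
    · simp
  · push Not at hx
    simp [hx]

end Operators

/-! ### Localization in a single coordinate. -/

section Coordinates

variable {𝕜 : Type*} [RCLike 𝕜] {n : ℕ} {K : Fin n → Type*} [∀ i, TopologicalSpace (K i)]
  [∀ i, CompactSpace (K i)]

/-- If both the evaluation at `p` and the restriction to `S` are small at `x`, then `x` is
concentrated on a clopen set that misses `p` and `S`. -/
theorem exists_clopen_norm_sub_coordMap_le [∀ i, T2Space (K i)] (m : Fin n)
    [TotallyDisconnectedSpace (K m)] (p : K m) (S : Clopens (K m))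
    (x : ProjTensor 𝕜 (fun i => C(K i, 𝕜))) {ε : ℝ} (hε : 0 < ε)
    (hp : ‖coordMap (E := fun i => C(K i, 𝕜)) m (evalOp 𝕜 p) x‖ ≤ ε)
    (hS : ‖coordMap (E := fun i => C(K i, 𝕜)) m (mulOp 𝕜 S) x‖ ≤ ε) :
    ∃ D : Clopens (K m), p ∉ D ∧ Disjoint S D ∧
      ‖x - coordMap (E := fun i => C(K i, 𝕜)) m (mulOp 𝕜 D) x‖ ≤ 3 * ε := by
  have hlim := tendsto_coordMap_zero (E := fun i => C(K i, 𝕜)) m _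
    (norm_one_sub_mulOp_mul_le p) (tendsto_one_sub_mulOp p) x
  obtain ⟨V, hV⟩ := (NormedAddGroup.tendsto_nhds_zero.mp hlim ε hε).exists
  refine ⟨V.1 \ S, fun h => V.2 h.1, disjoint_sdiff_self_right, ?_⟩
  rw [mulOp_sdiff]
  have := norm_sub_coordMap_le (E := fun i => C(K i, 𝕜)) m (S := mulOp 𝕜 S) (P := evalOp 𝕜 p)
    (norm_mulOp_le V.1) (norm_one_sub_mulOp_le V.1) x
  linarith

/-- Either every element of `Z` is constant in the `m`-th coordinate, or evaluation at `p` and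
multiplication by indicators of clopen sets missing `p` are singular on `Z`. -/
def ConcentratedAt (m : Fin n) (p : K m) (Z : Submodule 𝕜 (ProjTensor 𝕜 (fun i => C(K i, 𝕜)))) :
    Prop :=
  (∀ z ∈ Z, coordMap (E := fun i => C(K i, 𝕜)) m (evalOp 𝕜 p) z = z) ∨
    (SingularOn (coordMap (E := fun i => C(K i, 𝕜)) m (evalOp 𝕜 p)) Z ∧
      ∀ S : Clopens (K m), p ∉ S → SingularOn (coordMap (E := fun i => C(K i, 𝕜)) m (mulOp 𝕜 S)) Z)

theorem singularOn_mulOp_of_le {m : Fin n} {S T : Clopens (K m)} (hST : S ≤ T)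
    {Z : Submodule 𝕜 (ProjTensor 𝕜 (fun i => C(K i, 𝕜)))}
    (hT : SingularOn (coordMap (E := fun i => C(K i, 𝕜)) m (mulOp 𝕜 T)) Z) : SingularOn (coordMap (E := fun i => C(K i, 𝕜)) m (mulOp 𝕜 S)) Z := by
  refine hT.of_norm_le fun z _ => ?_
  rw [← inf_eq_left.mpr hST, ← mulOp_mul, coordMap_mul]
  exact norm_coordMap_apply_le_of_le_one (E := fun i => C(K i, 𝕜)) m (norm_mulOp_le S) _

theorem singularOn_mulOp_sup {m : Fin n} {S T : Clopens (K m)}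
    {Z : Submodule 𝕜 (ProjTensor 𝕜 (fun i => C(K i, 𝕜)))}
    (hS : SingularOn (coordMap (E := fun i => C(K i, 𝕜)) m (mulOp 𝕜 S)) Z) (hT : SingularOn (coordMap (E := fun i => C(K i, 𝕜)) m (mulOp 𝕜 T)) Z) :
    SingularOn (coordMap (E := fun i => C(K i, 𝕜)) m (mulOp 𝕜 (S ⊔ T))) Z := by
  refine hS.of_norm_le_add hT fun z => ?_
  rw [mulOp_sup, coordMap_add, coordMap_mul]
  refine (norm_add_le _ _).trans (add_le_add le_rfl ?_)
  exact norm_coordMap_apply_le_of_le_one (E := fun i => C(K i, 𝕜)) m (norm_one_sub_mulOp_le S) _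

/-- Singularity is a local property on a compact set: it passes to clopen subsets and to finite
unions. -/
theorem singularOn_mulOp_of_cover {m : Fin n}
    {Z : Submodule 𝕜 (ProjTensor 𝕜 (fun i => C(K i, 𝕜)))} (S : Clopens (K m))
    (hS : ∀ x ∈ S, ∃ V : Clopens (K m), x ∈ V ∧ SingularOn (coordMap (E := fun i => C(K i, 𝕜)) m (mulOp 𝕜 V)) Z) :
    SingularOn (coordMap (E := fun i => C(K i, 𝕜)) m (mulOp 𝕜 S)) Z := by
  have key : ∃ V : Clopens (K m), (S : Set (K m)) ⊆ V ∧ SingularOn (coordMap (E := fun i => C(K i, 𝕜)) m (mulOp 𝕜 V)) Z := by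
    refine IsCompact.induction_on (s := (S : Set (K m))) S.isClosed.isCompact
      (p := fun s => ∃ V : Clopens (K m), s ⊆ V ∧ SingularOn (coordMap (E := fun i => C(K i, 𝕜)) m (mulOp 𝕜 V)) Z)
      ?_ ?_ ?_ ?_
    · refine ⟨⊥, Set.empty_subset _, ?_⟩
      rw [mulOp_bot, coordMap_zero]
      exact singularOn_zero Z
    · rintro s t hst ⟨V, hV, hVZ⟩
      exact ⟨V, hst.trans hV, hVZ⟩
    · rintro s t ⟨V, hV, hVZ⟩ ⟨V', hV', hVZ'⟩
      exact ⟨V ⊔ V', Set.union_subset_union hV hV', singularOn_mulOp_sup hVZ hVZ'⟩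
    · intro x hx
      obtain ⟨V, hxV, hVZ⟩ := hS x hx
      exact ⟨V, mem_nhdsWithin_of_mem_nhds (V.isOpen.mem_nhds hxV), V, subset_rfl, hVZ⟩
  obtain ⟨V, hSV, hV⟩ := key
  exact singularOn_mulOp_of_le hSV hV

end Coordinates

/-! ### Concentration at points, gliding hump, and c₀-saturation. -/

section Saturation

variable {𝕜 : Type*} [RCLike 𝕜] {n : ℕ} {K : Fin n → Type*} [∀ i, TopologicalSpace (K i)]
  [∀ i, CompactSpace (K i)]

/-- Some clopen set `V` carries `Z` on an infinite-dimensional subspace, while the clopen subsets of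
`V` missing a certain point do not. -/
theorem exists_clopen_not_singularOn [∀ i, T2Space (K i)] (m : Fin n) (hK : IsScattered (K m))
    {Z : Submodule 𝕜 (ProjTensor 𝕜 (fun i => C(K i, 𝕜)))} (hZ : ¬ FiniteDimensional 𝕜 Z) :
    ∃ (p : K m) (V : Clopens (K m)),
      ¬ SingularOn (coordMap (E := fun i => C(K i, 𝕜)) m (mulOp 𝕜 V)) Z ∧
      ∀ S ≤ V, p ∉ S → SingularOn (coordMap (E := fun i => C(K i, 𝕜)) m (mulOp 𝕜 S)) Z := by
  have := hK.totallyDisconnectedSpace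
  set A : Set (K m) := {x | ¬ ∃ V : Clopens (K m), x ∈ V ∧
    SingularOn (coordMap (E := fun i => C(K i, 𝕜)) m (mulOp 𝕜 V)) Z} with hA
  have hAne : A.Nonempty := by
    by_contra hcon
    rw [Set.not_nonempty_iff_eq_empty] at hcon
    have htop := singularOn_mulOp_of_cover (Z := Z) (⊤ : Clopens (K m)) fun x _ => by
      by_contra hx
      have : x ∈ A := hx
      rw [hcon] at this
      exact this
    rw [mulOp_top, coordMap_one] at htop
    exact htop Z le_rfl hZ ⟨1, one_pos, fun w _ => by simp⟩
  -- A clopen V with p ∈ V ⊆ U meets A only in p, so every clopen S ≤ V missing p is covered by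
  -- singular sets.
  obtain ⟨p, hp, U, hU, hUA⟩ := hK A hAne
  have hpU : p ∈ U ∩ A := by rw [hUA]; rfl
  obtain ⟨V, hV, hpV, hVU⟩ := compact_exists_isClopen_in_isOpen hU hpU.1
  refine ⟨p, ⟨V, hV⟩, fun h => hp ⟨⟨V, hV⟩, hpV, h⟩, fun S hSV hpS => ?_⟩
  refine singularOn_mulOp_of_cover S fun x hx => ?_
  by_contra hxA
  have hxUA : x ∈ U ∩ A := ⟨hVU (hSV hx), hxA⟩
  rw [hUA] at hxUA
  exact hpS (hxUA ▸ hx)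

/-- Operators in coordinates k and m commute, so work in coordinate m does not spoil what was
achieved in k. -/
theorem ConcentratedAt.image {m k : Fin n} (hmk : k ≠ m) {p : K k}
    {T : C(K m, 𝕜) →L[𝕜] C(K m, 𝕜)} {Z Z' : Submodule 𝕜 (ProjTensor 𝕜 (fun i => C(K i, 𝕜)))}
    (hZ : ConcentratedAt k p Z)
    (hT : ∀ z ∈ Z', ∃ w ∈ Z, z = coordMap (E := fun i => C(K i, 𝕜)) m T w)
    (hR : ∀ R, Commute R (coordMap (E := fun i => C(K i, 𝕜)) m T) →
      SingularOn R Z → SingularOn R Z') : ConcentratedAt k p Z' := by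
  rcases hZ with h | ⟨h1, h2⟩
  · left
    intro z hz
    obtain ⟨w, hw, rfl⟩ := hT z hz
    have hc := DFunLike.congr_fun
      (coordMap_commute (E := fun i => C(K i, 𝕜)) hmk (evalOp 𝕜 p) T).eq w
    simp only [mul_apply_eq_comp] at hc
    rw [hc, h w hw]
  · right
    exact ⟨hR _ (coordMap_commute (E := fun i => C(K i, 𝕜)) hmk _ _) h1,
      fun S hS => hR _ (coordMap_commute (E := fun i => C(K i, 𝕜)) hmk _ _) (h2 S hS)⟩

/-- Up to isomorphism onto another subspace, `Z` can be concentrated in the `m`-th coordinate. -/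
theorem exists_concentratedAt [∀ i, T2Space (K i)] (m : Fin n) (hK : IsScattered (K m))
    {Z : Submodule 𝕜 (ProjTensor 𝕜 (fun i => C(K i, 𝕜)))} (hZcl : IsClosed (Z : Set (ProjTensor 𝕜 (fun i => C(K i, 𝕜)))))
    (hZ : ¬ FiniteDimensional 𝕜 Z) :
    ∃ Z' : Submodule 𝕜 (ProjTensor 𝕜 (fun i => C(K i, 𝕜))), IsClosed (Z' : Set (ProjTensor 𝕜 (fun i => C(K i, 𝕜)))) ∧
      ¬ FiniteDimensional 𝕜 Z' ∧ (ContainsC0 𝕜 Z' → ContainsC0 𝕜 Z) ∧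
      (∃ p, ConcentratedAt m p Z') ∧
      ∀ k ≠ m, ∀ p, ConcentratedAt k p Z → ConcentratedAt k p Z' := by
  obtain ⟨p, V, hV, hS⟩ := exists_clopen_not_singularOn m hK hZ
  obtain ⟨Z₁, hZ₁cl, hZ₁, hc₁, hT₁, hR₁⟩ := exists_image_of_not_singularOn hZcl hV
  have hmul : ∀ S : Clopens (K m), p ∉ S →
      SingularOn (coordMap (E := fun i => C(K i, 𝕜)) m (mulOp 𝕜 S)) Z₁ := by
    intro S hpS
    -- Elements of Z₁ are supported on V in coordinate m, so S and S ⊓ V act alike on them.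
    have h1 : SingularOn (coordMap (E := fun i => C(K i, 𝕜)) m (mulOp 𝕜 (S ⊓ V))) Z₁ := by
      refine hR₁ _ ?_ (hS _ inf_le_right fun h => hpS h.1)
      rw [Commute, SemiconjBy, ← coordMap_mul, ← coordMap_mul, mulOp_mul, mulOp_mul, inf_comm]
    refine h1.congr fun z hz => ?_
    obtain ⟨w, -, rfl⟩ := hT₁ z hz
    rw [← mul_apply_eq_comp, ← mul_apply_eq_comp, ← coordMap_mul, ← coordMap_mul, mulOp_mul,
      mulOp_mul, inf_assoc, inf_idem]
  by_cases hE : SingularOn (coordMap (E := fun i => C(K i, 𝕜)) m (evalOp 𝕜 p)) Z₁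
  · exact ⟨Z₁, hZ₁cl, hZ₁, hc₁, ⟨p, Or.inr ⟨hE, hmul⟩⟩, fun k hk q hq => hq.image hk hT₁ hR₁⟩
  · obtain ⟨Z₂, hZ₂cl, hZ₂, hc₂, hT₂, hR₂⟩ := exists_image_of_not_singularOn hZ₁cl hE
    refine ⟨Z₂, hZ₂cl, hZ₂, hc₁ ∘ hc₂, ⟨p, Or.inl fun z hz => ?_⟩,
      fun k hk q hq => (hq.image hk hT₁ hR₁).image hk hT₂ hR₂⟩
    obtain ⟨w, -, rfl⟩ := hT₂ z hz
    rw [← mul_apply_eq_comp, ← coordMap_mul, evalOp_mul_self]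

theorem exists_concentrated [∀ i, T2Space (K i)] (hK : ∀ i, IsScattered (K i))
    {Z : Submodule 𝕜 (ProjTensor 𝕜 (fun i => C(K i, 𝕜)))} (hZcl : IsClosed (Z : Set (ProjTensor 𝕜 (fun i => C(K i, 𝕜)))))
    (hZ : ¬ FiniteDimensional 𝕜 Z) (s : Finset (Fin n)) :
    ∃ Z' : Submodule 𝕜 (ProjTensor 𝕜 (fun i => C(K i, 𝕜))), IsClosed (Z' : Set (ProjTensor 𝕜 (fun i => C(K i, 𝕜)))) ∧
      ¬ FiniteDimensional 𝕜 Z' ∧ (ContainsC0 𝕜 Z' → ContainsC0 𝕜 Z) ∧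
      ∀ m ∈ s, ∃ p, ConcentratedAt m p Z' := by
  induction s using Finset.induction_on with
  | empty => exact ⟨Z, hZcl, hZ, id, by simp⟩
  | insert m s _ ih =>
    obtain ⟨Z₁, hcl₁, hinf₁, hc₁, hs₁⟩ := ih
    obtain ⟨Z₂, hcl₂, hinf₂, hc₂, hm, hpres⟩ := exists_concentratedAt m (hK m) hcl₁ hinf₁
    refine ⟨Z₂, hcl₂, hinf₂, hc₁ ∘ hc₂, fun k hk => ?_⟩
    by_cases hkm : k = m
    · subst hkm; exact hm
    · obtain ⟨p, hp⟩ := hs₁ k (Finset.mem_of_mem_insert_of_ne hk hkm)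
      exact ⟨p, hpres k hkm p hp⟩

variable (𝕜) in
open Classical in
/-- The factors of a block operator: multiplication by the indicator of `D i` for `i ∈ A`, evaluation
at `p i` for `i ∉ A`. -/
def blockFactor (A : Finset (Fin n)) (p : ∀ i, K i) (D : ∀ i, Clopens (K i)) (i : Fin n) :
    C(K i, 𝕜) →L[𝕜] C(K i, 𝕜) :=
  if i ∈ A then mulOp 𝕜 (D i) else evalOp 𝕜 (p i)

variable (𝕜) in
/-- The block operator with factors `blockFactor`. -/
def blockOp (A : Finset (Fin n)) (p : ∀ i, K i) (D : ∀ i, Clopens (K i)) :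
    ProjTensor 𝕜 (fun i => C(K i, 𝕜)) →L[𝕜] ProjTensor 𝕜 (fun i => C(K i, 𝕜)) :=
  projTensorMap 𝕜 (blockFactor 𝕜 A p D)

theorem norm_blockFactor_le (A : Finset (Fin n)) (p : ∀ i, K i) (D : ∀ i, Clopens (K i))
    (i : Fin n) : ‖blockFactor 𝕜 A p D i‖ ≤ 1 := by
  unfold blockFactor
  split_ifs
  · exact norm_mulOp_le _
  · exact norm_evalOp_le _

theorem blockOp_blockOp_self (A : Finset (Fin n)) (p : ∀ i, K i) (D : ∀ i, Clopens (K i))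
    (x : ProjTensor 𝕜 (fun i => C(K i, 𝕜))) :
    blockOp 𝕜 A p D (blockOp 𝕜 A p D x) = blockOp 𝕜 A p D x := by
  rw [← mul_apply_eq_comp, blockOp, ← projTensorMap_mul]
  congr 2
  ext1 i
  rw [Pi.mul_apply]
  unfold blockFactor
  split_ifs
  · rw [mulOp_mul, inf_idem]
  · rw [evalOp_mul_self]

/-- Disjointness in one coordinate of A suffices: that factor of the composite is zero. -/
theorem blockOp_blockOp_of_disjoint {A : Finset (Fin n)} {m : Fin n} (hm : m ∈ A) (p : ∀ i, K i)
    {D D' : ∀ i, Clopens (K i)} (hD : Disjoint (D m) (D' m))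
    (x : ProjTensor 𝕜 (fun i => C(K i, 𝕜))) : blockOp 𝕜 A p D (blockOp 𝕜 A p D' x) = 0 := by
  have h0 : ‖(blockFactor 𝕜 A p D * blockFactor 𝕜 A p D') m‖ = 0 := by
    rw [Pi.mul_apply]
    unfold blockFactor
    rw [if_pos hm, if_pos hm, mulOp_mul, hD.eq_bot, mulOp_bot, norm_zero]
  rw [← mul_apply_eq_comp, blockOp, blockOp, ← projTensorMap_mul]
  have h1 := norm_projTensorMap_apply_le (E := fun i => C(K i, 𝕜)) (F := fun i => C(K i, 𝕜))
    (blockFactor 𝕜 A p D * blockFactor 𝕜 A p D') x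
  rw [Finset.prod_eq_zero (Finset.mem_univ m) h0, zero_mul] at h1
  exact norm_le_zero_iff.mp h1

theorem norm_sum_blockOp_le {A : Finset (Fin n)} (hA : A.Nonempty) (p : ∀ i, K i)
    {D : ℕ → ∀ i, Clopens (K i)} (hD : ∀ j k, j ≠ k → ∀ i, Disjoint (D j i) (D k i))
    (F : Finset ℕ) (x : ℕ → ProjTensor 𝕜 (fun i => C(K i, 𝕜))) {M : ℝ} (hM : 0 ≤ M)
    (hx : ∀ j ∈ F, ‖x j‖ ≤ M) : ‖∑ j ∈ F, blockOp 𝕜 A p (D j) (x j)‖ ≤ M := by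
  refine norm_sum_finset_block_le (E := fun i => C(K i, 𝕜)) F (fun j => blockFactor 𝕜 A p (D j)) A
    hA ?_ ?_ x hM hx
  · intro i hi f hf
    simp only [blockFactor, if_pos hi]
    exact norm_sum_mulOp_le (fun j : F => D j i)
      (fun j k hjk => hD j k (fun h => hjk (Subtype.ext h)) i) f hf
  · intro i hi
    refine ⟨1, norm_one_continuousMap_le, fun f hf => ⟨f (p i),
      (f.norm_coe_le_norm _).trans hf, fun j => ?_⟩⟩
    simp only [blockFactor, if_neg hi, evalOp_apply]

/-- One step of the gliding hump. -/
theorem exists_near_block [∀ i, T2Space (K i)] [∀ i, TotallyDisconnectedSpace (K i)]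
    (A : Finset (Fin n)) (p : ∀ i, K i) {Z : Submodule 𝕜 (ProjTensor 𝕜 (fun i => C(K i, 𝕜)))}
    (hZ : ¬ FiniteDimensional 𝕜 Z)
    (hfix : ∀ m ∉ A, ∀ z ∈ Z, coordMap (E := fun i => C(K i, 𝕜)) m (evalOp 𝕜 (p m)) z = z)
    (heval : ∀ m ∈ A, SingularOn (coordMap (E := fun i => C(K i, 𝕜)) m (evalOp 𝕜 (p m))) Z)
    (hmul : ∀ m ∈ A, ∀ S : Clopens (K m), p m ∉ S →
      SingularOn (coordMap (E := fun i => C(K i, 𝕜)) m (mulOp 𝕜 S)) Z)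
    (S : ∀ i, Clopens (K i)) (hS : ∀ i, p i ∉ S i) {ε : ℝ} (hε : 0 < ε) :
    ∃ z ∈ Z, ‖z‖ = 1 ∧ ∃ D : ∀ i, Clopens (K i), (∀ i, p i ∉ D i) ∧
      (∀ i, Disjoint (S i) (D i)) ∧ ‖z - blockOp 𝕜 A p D z‖ ≤ ε := by
  -- Each of the n coordinates contributes at most 3 δ; the extra 1 avoids division by zero.
  set δ : ℝ := ε / (3 * (n + 1)) with hδdef
  have hδ : 0 < δ := by positivity
  obtain ⟨W₁, hW₁, hinf₁, hb₁⟩ := exists_subspace_norm_le hZ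
    (fun m => coordMap (E := fun i => C(K i, 𝕜)) m (evalOp 𝕜 (p m))) A heval hδ
  obtain ⟨W₂, hW₂, hinf₂, hb₂⟩ := exists_subspace_norm_le hinf₁
    (fun m => coordMap (E := fun i => C(K i, 𝕜)) m (mulOp 𝕜 (S m))) A
    (fun m hm => (hmul m hm (S m) (hS m)).mono hW₁) hδ
  -- The zero operator serves only to produce a unit vector of W₂.
  obtain ⟨z, hz, hz1, -⟩ := (singularOn_zero (Y := 𝕜) W₂).exists_norm_lt hinf₂ one_pos
  have hzZ : z ∈ Z := hW₁ (hW₂ hz)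
  have hex : ∀ m, ∃ D : Clopens (K m), p m ∉ D ∧ Disjoint (S m) D ∧
      (m ∈ A → ‖z - coordMap (E := fun i => C(K i, 𝕜)) m (mulOp 𝕜 D) z‖ ≤ 3 * δ) := by
    intro m
    by_cases hm : m ∈ A
    · obtain ⟨D, h1, h2, h3⟩ := exists_clopen_norm_sub_coordMap_le m (p m) (S m) z hδ
        (by simpa [hz1] using hb₁ m hm z (hW₂ hz)) (by simpa [hz1] using hb₂ m hm z hz)
      exact ⟨D, h1, h2, fun _ => h3⟩
    -- Off A the block operator evaluates at p m, so the clopen set is a dummy; ⊥ keeps the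
    -- disjointness conditions true.
    · exact ⟨⊥, id, disjoint_bot_right, fun h => absurd h hm⟩
  choose D hpD hSD hD using hex
  refine ⟨z, hzZ, hz1, D, hpD, hSD, ?_⟩
  refine (norm_sub_projTensorMap_le (E := fun i => C(K i, 𝕜))
    (fun i => norm_blockFactor_le A p D i) z).trans ?_
  calc ∑ i, ‖z - coordMap (E := fun i => C(K i, 𝕜)) i (blockFactor 𝕜 A p D i) z‖
      ≤ ∑ _i : Fin n, 3 * δ := by
        refine Finset.sum_le_sum fun i _ => ?_
        by_cases hi : i ∈ A
        · simpa only [blockFactor, if_pos hi] using hD i hi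
        · simp only [blockFactor, if_neg hi]
          rw [hfix i hi z hzZ, sub_self, norm_zero]
          positivity
    _ = n * (3 * δ) := by simp
    _ ≤ ε := by
        have : ε = (n + 1) * (3 * δ) := by rw [hδdef]; field_simp
        nlinarith

theorem containsC0_of_concentrated [∀ i, T2Space (K i)] [∀ i, TotallyDisconnectedSpace (K i)]
    {A : Finset (Fin n)} (hA : A.Nonempty) (p : ∀ i, K i)
    {Z : Submodule 𝕜 (ProjTensor 𝕜 (fun i => C(K i, 𝕜)))} (hZcl : IsClosed (Z : Set (ProjTensor 𝕜 (fun i => C(K i, 𝕜)))))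
    (hZ : ¬ FiniteDimensional 𝕜 Z)
    (hfix : ∀ m ∉ A, ∀ z ∈ Z, coordMap (E := fun i => C(K i, 𝕜)) m (evalOp 𝕜 (p m)) z = z)
    (heval : ∀ m ∈ A, SingularOn (coordMap (E := fun i => C(K i, 𝕜)) m (evalOp 𝕜 (p m))) Z)
    (hmul : ∀ m ∈ A, ∀ S : Clopens (K m), p m ∉ S →
      SingularOn (coordMap (E := fun i => C(K i, 𝕜)) m (mulOp 𝕜 S)) Z) :
    ContainsC0 𝕜 Z := by
  classical
  -- The terms are triples (δ, D, z). Starting at 1 / 8 and halving keeps the total error within the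
  -- 1 / 4 required by `containsC0_of_blocks`.
  obtain ⟨u, hP, hr⟩ := exists_seq_of_forall_finset_exists
    (fun a : ℝ × (∀ i, Clopens (K i)) × ProjTensor 𝕜 (fun i => C(K i, 𝕜)) =>
      0 < a.1 ∧ a.1 ≤ 1 / 8 ∧ (∀ i, p i ∉ a.2.1 i) ∧ a.2.2 ∈ Z ∧ ‖a.2.2‖ = 1 ∧
        ‖a.2.2 - blockOp 𝕜 A p a.2.1 a.2.2‖ ≤ a.1)
    (fun a b => b.1 ≤ a.1 / 2 ∧ ∀ i, Disjoint (a.2.1 i) (b.2.1 i)) (by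
      intro s hs
      obtain ⟨δ, hδ, hδε, hδs⟩ : ∃ δ : ℝ, 0 < δ ∧ δ ≤ 1 / 8 ∧ ∀ a ∈ s, δ ≤ a.1 / 2 := by
        induction s using Finset.induction_on with
        | empty => exact ⟨1 / 8, by positivity, le_rfl, by simp⟩
        | insert a s _ ih =>
          obtain ⟨δ, h1, h2, h3⟩ := ih fun x hx => hs x (Finset.mem_insert_of_mem hx)
          have := (hs a (Finset.mem_insert_self _ _)).1
          refine ⟨min δ (a.1 / 2), by positivity, (min_le_left _ _).trans h2, ?_⟩
          intro b hb
          rcases Finset.mem_insert.mp hb with rfl | hb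
          · exact min_le_right _ _
          · exact (min_le_left _ _).trans (h3 b hb)
      obtain ⟨z, hz, hz1, D, hpD, hSD, hzD⟩ := exists_near_block A p hZ hfix heval hmul
        (fun i => s.sup fun a => a.2.1 i) (fun i hi => by
          rw [← SetLike.mem_coe, Clopens.coe_finset_sup] at hi
          simp only [Set.mem_iUnion] at hi
          obtain ⟨a, ha, hia⟩ := hi
          exact (hs a ha).2.2.1 i hia) hδ
      exact ⟨(δ, D, z), ⟨hδ, hδε, hpD, hz, hz1, hzD⟩, fun a ha => ⟨hδs a ha, fun i =>
        (hSD i).mono_left (Finset.le_sup (f := fun a => a.2.1 i) ha)⟩⟩)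
  have hdisj : ∀ j k, j ≠ k → ∀ i, Disjoint ((u j).2.1 i) ((u k).2.1 i) := by
    intro j k hjk i
    rcases lt_or_gt_of_ne hjk with h | h
    · exact (hr j k h).2 i
    · exact ((hr k j h).2 i).symm
  have hδ : ∀ k, (u k).1 ≤ 1 / 8 * (1 / 2) ^ k := by
    intro k
    induction k with
    | zero => simpa using (hP 0).2.1
    | succ k ih =>
      have := (hr k (k + 1) (Nat.lt_succ_self k)).1
      rw [pow_succ]
      linarith
  obtain ⟨m, hm⟩ := hA
  refine containsC0_of_blocks Z hZcl (fun j => (u j).2.2) (fun j => blockOp 𝕜 A p (u j).2.1)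
    (fun j => (u j).1) (fun j => (hP j).2.2.2.1) (fun j => (hP j).2.2.2.2.1)
    (fun j x => norm_projTensorMap_apply_le_of_le_one (E := fun i => C(K i, 𝕜))
      (norm_blockFactor_le A p _) x)
    (fun j x => blockOp_blockOp_self A p _ x)
    (fun j k hjk x => blockOp_blockOp_of_disjoint hm p (hdisj j k hjk m) x)
    (fun F x M hM hx => norm_sum_blockOp_le ⟨m, hm⟩ p hdisj F x hM hx)
    (fun j => (hP j).2.2.2.2.2) fun F => ?_
  calc ∑ j ∈ F, (u j).1 ≤ ∑ j ∈ F, 1 / 8 * (1 / 2 : ℝ) ^ j := Finset.sum_le_sum fun j _ => hδ j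
    _ = 1 / 8 * ∑ j ∈ F, (1 / 2 : ℝ) ^ j := by rw [Finset.mul_sum]
    _ ≤ 1 / 8 * 2 := by
        gcongr
        refine (summable_geometric_two.sum_le_tsum F fun j _ => by positivity).trans ?_
        rw [tsum_geometric_two]
    _ = 1 / 4 := by norm_num

/-- Projective tensor products of `C(K)` spaces, `K` scattered, are `c₀`-saturated. -/
theorem containsC0_of_isScattered [∀ i, T2Space (K i)] (hK : ∀ i, IsScattered (K i))
    {Z : Submodule 𝕜 (ProjTensor 𝕜 (fun i => C(K i, 𝕜)))} (hZcl : IsClosed (Z : Set (ProjTensor 𝕜 (fun i => C(K i, 𝕜)))))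
    (hZ : ¬ FiniteDimensional 𝕜 Z) : ContainsC0 𝕜 Z := by
  classical
  have : ∀ i, TotallyDisconnectedSpace (K i) := fun i => (hK i).totallyDisconnectedSpace
  obtain ⟨Z', hcl, hinf, hc, hconc⟩ := exists_concentrated hK hZcl hZ Finset.univ
  choose p hp using fun m => hconc m (Finset.mem_univ m)
  apply hc
  set A := Finset.univ.filter fun m =>
    ¬ ∀ z ∈ Z', coordMap (E := fun i => C(K i, 𝕜)) m (evalOp 𝕜 (p m)) z = z with hAdef
  have hfix : ∀ m ∉ A, ∀ z ∈ Z',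
      coordMap (E := fun i => C(K i, 𝕜)) m (evalOp 𝕜 (p m)) z = z := by
    intro m hm
    simpa [hAdef] using hm
  have hsing := fun m (hm : m ∈ A) => (hp m).resolve_left (Finset.mem_filter.mp hm).2
  rcases A.eq_empty_or_nonempty with hA | hA
  · exact absurd (finiteDimensional_of_coordMap_eq (E := fun i => C(K i, 𝕜))
      (fun i => evalOp 𝕜 (p i)) (fun _ => 1) (fun i => norm_evalOp_le (p i))
      (fun i f => ⟨f (p i), rfl⟩) fun m => hfix m (by simp [hA])) hinf
  · exact containsC0_of_concentrated hA p hcl hinf hfix (fun m hm => (hsing m hm).1)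
      fun m hm => (hsing m hm).2

end Saturation

end ProjTensorCK

end

theorem proposition3p5 {𝕜 : Type v} [RCLike 𝕜] {n : ℕ} (K : Fin n → Type u)
    [∀ i, TopologicalSpace (K i)] [∀ i, CompactSpace (K i)] [∀ i, T2Space (K i)]
    [∀ i, Infinite (K i)] (hK : ∀ i, ProjTensorCK.IsScattered (K i))
    (Z : Submodule 𝕜 (ProjTensorCK.ProjTensor 𝕜 (fun i => C(K i, 𝕜))))
    (hZ_closed : IsClosed (Z : Set (ProjTensorCK.ProjTensor 𝕜 (fun i => C(K i, 𝕜)))))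
    (hZ_inf : ¬ FiniteDimensional 𝕜 Z)
    (hZ : ∀ (m : Fin n) (S : TopologicalSpace.Closeds (K m)),
      ProjTensorCK.gammaIndex S < ProjTensorCK.gammaIndex (K m) →
        ProjTensorCK.StrictlySingular 𝕜
          ((ProjTensorCK.restrictOp 𝕜 K m S).comp Z.subtypeL)) :
    ProjTensorCK.ContainsC0 𝕜 Z := by
  exact ProjTensorCK.containsC0_of_isScattered hK hZ_closed hZ_inf
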